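/- Let $\alpha\in(0,1)$ and $k(t)=t^{-\alpha}/\Gamma(1-\alpha)$ for $t>0$. For every $\tau\in(0,\infty)$ there is a measurable weight $w:[0,1]\to[1,\infty)$, bounded on $[\delta,1]$ for every $\delta>0$, such that, with $H=L_2([0,1];\mathbb C)$ and $V=L_2([0,1],w\,dx;\mathbb C)$, the natural embeddings give a Gelfand triple $V\hookrightarrow H\hookrightarrow V'$ (that is, $V\subset H$ continuously and densely), and there is a family of sesquilinear forms $a(t;\cdot,\cdot):V\times V\to\mathbb C$, $t\in[0,\tau]$, with the following properties. (1) There are constants $M,\gamma>0$ with $|a(t;u,v)|\le M\|u\|_V\|v\|_V$ and $\operatorname{Re}a(t;u,u)\ge\gamma\|u\|_V^2$ for all $t\in[0,\tau]$ and $u,v\in V$. (2) There is $K\ge 0$ with $|a(t;u,v)-a(s;u,v)|\le K|t-s|^{\alpha/2}\|u\|_V\|v\|_V$ for all $t,s\in[0,\tau]$ and $u,v\in V$. (3) Let $A(t)$ be the operator in $H$ associated with $a(t;\cdot,\cdot)$: $x\in D(A(t))$ and $A(t)x=y$ if and only if $x\in V$, $y\in H$ and $a(t;x,v)=(y,v)_H$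 for all $v\in V$. Then there is $f\in L_2(0,\tau;H)$ for which the fractional problem $$\partial_t^\alpha u(t)+A(t)u(t)=f(t)\ \text{ for a.e. } t\in(0,\tau),\qquad u(0)=0,$$ fails to have maximal $L_2$-regularity in $H$: it has no solution $u\in L_1(0,\tau;H)$ with $\partial_t^\alpha u\in L_2(0,\tau;H)$, $u(t)\in D(A(t))$ for a.e. $t\in(0,\tau)$, and $A(\cdot)u(\cdot)\in L_2(0,\tau;H)$. Here $\partial_t^\alpha u$ is the Caputo derivative with initial value $u(0)=0$, that is, $\partial_t^\alpha u=g$ means that $\int_0^t k(t-s)u(s)\,ds=\int_0^t g(s)\,ds$ for a.e. $t\in(0,\tau)$. -/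

import Mathlib

open MeasureTheory Set

noncomputable section

namespace FracMR

/-- The Hilbert space `L₂[0,1]` of complex-valued functions. -/
abbrev HSpace : Type := Lp ℂ 2 (volume.restrict (Icc (0 : ℝ) 1))

/-- The measure `w dx` on `[0,1]`. -/
def weightedMeasure (w : ℝ → ℝ) : Measure ℝ :=
  (volume.restrict (Icc (0 : ℝ) 1)).withDensity fun x => ENNReal.ofReal (w x)

/-- The weighted Hilbert space `L₂([0,1]; w dx)` of complex-valued functions. -/
abbrev VSpace (w : ℝ → ℝ) : Type := Lp ℂ 2 (weightedMeasure w)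

/-- `w` is a measurable weight on `[0,1]` with values in `[1,∞)`, locally bounded on `(0,1]`. -/
structure IsWeight (w : ℝ → ℝ) : Prop where
  measurable : Measurable w
  one_le : ∀ x ∈ Icc (0 : ℝ) 1, 1 ≤ w x
  locallyBounded : ∀ δ : ℝ, 0 < δ → ∃ C : ℝ, ∀ x ∈ Icc δ 1, w x ≤ C

section Abstract

variable {V H : Type*}
  [NormedAddCommGroup V] [InnerProductSpace ℂ V]
  [NormedAddCommGroup H] [InnerProductSpace ℂ H]

/-- The continuous linear map `j : V → H` is injective with dense range, i.e. it induces a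
Gelfand triple `V ↪ H ↪ V'`. -/
structure IsGelfandEmbedding (j : V →L[ℂ] H) : Prop where
  injective : Function.Injective j
  denseRange : DenseRange j

/-- Uniform boundedness and uniform coercivity, for `t ∈ [0,τ]`, of a non-autonomous
sesquilinear form (linear in the first, conjugate-linear in the second argument). -/
def IsBoundedCoercive (τ : ℝ) (a : ℝ → V →ₗ[ℂ] V →ₗ⋆[ℂ] ℂ) : Prop :=
  ∃ M γ : ℝ, 0 < M ∧ 0 < γ ∧ ∀ t ∈ Icc 0 τ,
    (∀ u v : V, ‖a t u v‖ ≤ M * ‖u‖ * ‖v‖) ∧ ∀ u : V, γ * ‖u‖ ^ 2 ≤ (a t u u).re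

/-- Hölder continuity in time, of exponent `β`, of a non-autonomous form on `[0,τ]`. -/
def IsHolderForm (τ β : ℝ) (a : ℝ → V →ₗ[ℂ] V →ₗ⋆[ℂ] ℂ) : Prop :=
  ∃ K : ℝ, 0 ≤ K ∧ ∀ t ∈ Icc 0 τ, ∀ s ∈ Icc 0 τ, ∀ u v : V,
    ‖a t u v - a s u v‖ ≤ K * |t - s| ^ β * ‖u‖ * ‖v‖

/-- `x ∈ D(A)` and `A x = y`, where `A` is the part in `H` of the operator `V → V'` associated
with the form `b`: the vector `x` comes from some `u ∈ V` and `b(u, v) = (y, v)_H` for all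
`v ∈ V`. The inner product of Mathlib is linear in its second argument. -/
def OperatorGraph (j : V →L[ℂ] H) (b : V →ₗ[ℂ] V →ₗ⋆[ℂ] ℂ) (x y : H) : Prop :=
  ∃ u : V, j u = x ∧ ∀ v : V, b u v = inner ℂ (j v) y

/-- The kernel `k(t) = t^{-α} / Γ(1-α)`. -/
def fracKernel (α t : ℝ) : ℝ := t ^ (-α) / Real.Gamma (1 - α)

/-- `g = ∂ₜ^α u` on `(0,τ)`, the Caputo derivative with initial value `u(0) = u₀`: the function
`k * (u - u₀)` is absolutely continuous (up to a null set), vanishes at `0`, and has the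
derivative `g`. -/
structure HasCaputoDeriv (α τ : ℝ) (u : ℝ → H) (u₀ : H) (g : ℝ → H) : Prop where
  integrable : IntegrableOn u (Ioo 0 τ)
  integrable_deriv : IntegrableOn g (Ioo 0 τ)
  primitive : ∀ᵐ t ∂volume.restrict (Ioo 0 τ),
    ∫ s in (0 : ℝ)..t, fracKernel α (t - s) • (u s - u₀) = ∫ s in (0 : ℝ)..t, g s

/-- `u` is a solution in the maximal regularity class `MR_2^α(0,τ;H)` of the problem
`∂ₜ^α u + A(t) u = f` a.e. on `(0,τ)`, `u(0) = u₀`: the functions `g = ∂ₜ^α u` and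
`h = A(·)u(·)` exist and both lie in `L₂(0,τ;H)`. -/
def IsMaxRegSolution (α τ : ℝ) (j : V →L[ℂ] H) (a : ℝ → V →ₗ[ℂ] V →ₗ⋆[ℂ] ℂ)
    (u₀ : H) (f : ℝ → H) (u : ℝ → H) : Prop :=
  ∃ g h : ℝ → H,
    HasCaputoDeriv α τ u u₀ g ∧
    MemLp g 2 (volume.restrict (Ioo 0 τ)) ∧
    MemLp h 2 (volume.restrict (Ioo 0 τ)) ∧
    (∀ᵐ t ∂volume.restrict (Ioo 0 τ), OperatorGraph j (a t) (u t) (h t)) ∧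
    ∀ᵐ t ∂volume.restrict (Ioo 0 τ), g t + h t = f t

end Abstract

end FracMR

end

open Filter Topology

namespace FracMR

/-! ### Causal convolutions: integrability and Fubini. -/

section Convolution

variable {E : Type*} [NormedAddCommGroup E] [NormedSpace ℝ E]

/-! The weight is constant on dyadic intervals, so their normalized indicators `b n` are orthonormal
in `H` and are eigenvectors of the multiplication operator given by `w`, with eigenvalues `1, 1,
2^α, 4^α, …`. The form is `(u, v)_V` plus the rank-one term `(u, b 0)_V (z t, v)_V`, where `z t = ε
∑ₖ ωₖ^{-α} e^{iωₖt} b (k+1)` and `ωₖ = 2^k`. Since `‖b (k+1)‖_V = ωₖ^{α/2}`, the series for `z` is a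
Weierstrass-type lacunary series in `V`, Hölder of exponent exactly `α/2` by the dyadic sum bound
`exists_sum_dyadic_min_le` (`exists_lacunary_curve`). For small `ε` the form stays coercive.

As a functional on `H`, however, `z t` has coefficients `ε e^{iωₖt}`, which do not decay. Take `f =
b 0` and suppose `u` solves the problem with `h = A(·)u` in `L₂(0,τ;H)`. Write `u₀ = (b 0, u)_H`,
and let `vₖ`, `hₖ` be the coordinates of `u`, `h` along `b (k+1)`. Then `∂ₜ^α vₖ = -hₖ` and `hₖ =
ωₖ^α vₖ + ε u₀ e^{iωₖt}`. Testing on `(0, b)` against `ωₖ e^{-iωₖt}` eliminates `vₖ`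
(`tested_equation`): the homogeneity of the kernel turns `ωₖ` into `ωₖ^α`, and what remains
expresses `ε ∫ u₀(s) F(ωₖ(b-s)) ds`, with `F` the truncated Fourier transform of the kernel, through
an integral of `hₖ` against bounded factors. As `k → ∞`, `hₖ → 0` pointwise by Bessel, dominated by
`‖h‖`, while `F` stays bounded and tends to a nonzero limit. Hence `∫₀ᵇ u₀ = 0` for all `b`, so `u₀
= 0` almost everywhere (`ae_eq_zero_of_tendsto_components`). But then the coordinate along `b 0` of
the equation reads `0 = 1`. -/

theorem ae_intervalIntegrable_kernel_smul {κ : ℝ → ℝ} {φ : ℝ → E} {b : ℝ}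
    (hκ : IntegrableOn κ (Ioo 0 b)) (hφ : IntegrableOn φ (Ioo 0 b)) :
    ∀ᵐ t ∂volume.restrict (Ioo 0 b),
      IntervalIntegrable (fun s => κ (t - s) • φ s) volume 0 t := by
  have h := Integrable.ae_convolution_exists (ContinuousLinearMap.lsmul ℝ ℝ (E := E)).flip
    ((integrable_indicator_iff measurableSet_Ioo).2 hφ)
    ((integrable_indicator_iff measurableSet_Ioo).2 hκ)
  rw [ae_restrict_iff' measurableSet_Ioo]
  filter_upwards [h] with t ht htb
  rw [intervalIntegrable_iff_integrableOn_Ioo_of_le htb.1.le]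
  refine (ht.integrableOn (s := Ioo 0 t)).congr_fun (fun s hs => ?_) measurableSet_Ioo
  have h1 : s ∈ Ioo 0 b := ⟨hs.1, hs.2.trans htb.2⟩
  have h2 : t - s ∈ Ioo 0 b := ⟨by linarith [hs.2], by linarith [hs.1, htb.2]⟩
  simp only [ContinuousLinearMap.flip_apply, ContinuousLinearMap.lsmul_apply,
    indicator_of_mem h1, indicator_of_mem h2]

/-- Fubini's theorem for a causal convolution tested against a bounded function. -/
theorem integral_convolution_mul {κ : ℝ → ℝ} {φ e : ℝ → ℂ} {b C : ℝ} (hb : 0 ≤ b)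
    (hκ : IntegrableOn κ (Ioo 0 b)) (hφ : IntegrableOn φ (Ioo 0 b))
    (he : Continuous e) (hC : ∀ t, ‖e t‖ ≤ C) :
    ∫ t in (0 : ℝ)..b, (∫ s in (0 : ℝ)..t, κ (t - s) • φ s) * e t =
      ∫ s in (0 : ℝ)..b, φ s * ∫ r in (0 : ℝ)..(b - s), κ r • e (s + r) := by
  have h := Integrable.convolution_integrand (ContinuousLinearMap.lsmul ℝ ℝ (E := ℂ)).flip
    ((integrable_indicator_iff measurableSet_Ioo).2 hφ)
    ((integrable_indicator_iff measurableSet_Ioo).2 hκ)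
  -- The convolution of the two zero extensions does not vanish beyond `b`, so the test function is
  -- cut off at `b`.
  have hem : AEStronglyMeasurable (fun p : ℝ × ℝ => (Iio b).indicator e p.1)
      ((volume : Measure ℝ).prod (volume : Measure ℝ)) :=
    ((he.measurable.indicator measurableSet_Iio).comp measurable_fst).aestronglyMeasurable
  have h2 := h.bdd_mul (c := C) hem (ae_of_all _ fun p => by
    refine (norm_indicator_le_norm_self _ _).trans (hC _))
  have hsw := integral_integral_swap (f := fun t s => (Iio b).indicator e t *
    (((ContinuousLinearMap.lsmul ℝ ℝ (E := ℂ)).flip ((Ioo 0 b).indicator φ s))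
      ((Ioo 0 b).indicator κ (t - s)))) h2
  simp only [ContinuousLinearMap.flip_apply, ContinuousLinearMap.lsmul_apply] at hsw
  rw [intervalIntegral.integral_of_le hb, intervalIntegral.integral_of_le hb,
    integral_Ioc_eq_integral_Ioo, integral_Ioc_eq_integral_Ioo,
    ← integral_indicator measurableSet_Ioo, ← integral_indicator measurableSet_Ioo]
  refine Eq.trans ?_ (hsw.trans ?_)
  · refine integral_congr_ae (ae_of_all _ fun t => ?_)
    by_cases ht : t ∈ Ioo 0 b
    · simp only [indicator_of_mem ht, indicator_of_mem (show t ∈ Iio b from ht.2)]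
      rw [integral_const_mul, mul_comm, intervalIntegral.integral_of_le ht.1.le,
        integral_Ioc_eq_integral_Ioo, ← integral_indicator measurableSet_Ioo]
      congr 1
      refine integral_congr_ae (ae_of_all _ fun s => ?_)
      by_cases hs : s ∈ Ioo 0 t
      · have h1 : s ∈ Ioo 0 b := ⟨hs.1, hs.2.trans ht.2⟩
        have h2 : t - s ∈ Ioo 0 b := ⟨by linarith [hs.2], by linarith [hs.1, ht.2]⟩
        simp only [indicator_of_mem h1, indicator_of_mem h2, indicator_of_mem hs]
      · by_cases h1 : s ∈ Ioo 0 b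
        · have h2 : t - s ∉ Ioo 0 b := fun h => hs ⟨h1.1, by linarith [h.1]⟩
          simp only [indicator_of_notMem h2, indicator_of_notMem hs, zero_smul]
        · simp only [indicator_of_notMem h1, indicator_of_notMem hs, smul_zero]
    · simp only [indicator_of_notMem ht]
      by_cases htb : t < b
      · have ht0 : t ≤ 0 := not_lt.1 fun h => ht ⟨h, htb⟩
        rw [integral_eq_zero_of_ae]
        refine ae_of_all _ fun s => ?_
        by_cases h1 : s ∈ Ioo 0 b
        · have h2 : t - s ∉ Ioo 0 b := fun h => by linarith [h.1, h1.1]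
          simp only [indicator_of_notMem h2, zero_smul, mul_zero, Pi.zero_apply]
        · simp only [indicator_of_notMem h1, smul_zero, mul_zero, Pi.zero_apply]
      · simp [htb]
  · refine integral_congr_ae (ae_of_all _ fun s => ?_)
    by_cases hs : s ∈ Ioo 0 b
    · simp only [indicator_of_mem hs]
      have hsb : 0 ≤ b - s := by linarith [hs.2]
      rw [intervalIntegral.integral_of_le hsb, integral_Ioc_eq_integral_Ioo,
        ← integral_indicator measurableSet_Ioo, ← integral_const_mul,
        ← integral_add_left_eq_self _ s]
      refine integral_congr_ae (ae_of_all _ fun r => ?_)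
      by_cases hr : r ∈ Ioo 0 (b - s)
      · have h1 : s + r - s ∈ Ioo 0 b := ⟨by linarith [hr.1], by linarith [hr.2, hs.1]⟩
        have h2 : s + r ∈ Iio b := by simp only [mem_Iio]; linarith [hr.2]
        beta_reduce
        rw [indicator_of_mem h1, indicator_of_mem h2, indicator_of_mem hr, add_sub_cancel_left]
        rw [mul_smul_comm, mul_smul_comm, mul_comm]
      · by_cases h2 : s + r ∈ Iio b
        · have h1 : s + r - s ∉ Ioo 0 b := fun h => hr
            ⟨by linarith [h.1], by simp only [mem_Iio] at h2; linarith⟩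
          simp only [indicator_of_notMem h1, indicator_of_notMem hr, zero_smul, mul_zero]
        · simp only [indicator_of_notMem h2, indicator_of_notMem hr, zero_mul, mul_zero]
    · simp only [indicator_of_notMem hs, smul_zero, mul_zero, integral_zero]

end Convolution

/-! ### Truncated Fourier integrals of the fractional kernel. -/

section OscillatoryIntegral

/-- At the origin the quadratic vanishing of `1 - cos` beats the singularity: the product is at most
`x ^ (2 - α)`. -/
theorem one_sub_cos_rpow_continuousOn {α : ℝ} (hα1 : α < 1) :
    ContinuousOn (fun x : ℝ => x ^ (-α) * (1 - Real.cos x)) (Ici 0) := by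
  intro x hx
  rcases (mem_Ici.1 hx).eq_or_lt with rfl | hx
  · have hlim : Tendsto (fun x : ℝ => x ^ (2 - α)) (𝓝[Ici 0] 0) (𝓝 0) := by
      have : ContinuousAt (fun x : ℝ => x ^ (2 - α)) 0 :=
        Real.continuousAt_rpow_const _ _ (Or.inr (by linarith))
      have h := this.tendsto
      rw [Real.zero_rpow (by linarith)] at h
      exact h.mono_left nhdsWithin_le_nhds
    rw [ContinuousWithinAt]
    simp only [Real.cos_zero, sub_self, mul_zero]
    refine squeeze_zero_norm' ?_ hlim
    filter_upwards [self_mem_nhdsWithin] with y hy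
    have hy0 : (0 : ℝ) ≤ y := hy
    have h1 : 0 ≤ 1 - Real.cos y := by linarith [Real.cos_le_one y]
    have h2 : 1 - Real.cos y ≤ y ^ 2 := by
      nlinarith [Real.one_sub_sq_div_two_le_cos (x := y), sq_nonneg y]
    rw [Real.norm_of_nonneg (mul_nonneg (Real.rpow_nonneg hy0 _) h1)]
    rcases hy0.eq_or_lt with rfl | hy0
    · simp only [Real.cos_zero, sub_self, mul_zero]; positivity
    · calc y ^ (-α) * (1 - Real.cos y) ≤ y ^ (-α) * y ^ 2 := by gcongr
        _ = y ^ (2 - α) := by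
          rw [← Real.rpow_natCast, ← Real.rpow_add hy0]; congr 1; push_cast; ring
  · have : ContinuousAt (fun x : ℝ => x ^ (-α)) x :=
      Real.continuousAt_rpow_const _ _ (Or.inl hx.ne')
    exact (this.mul (by fun_prop)).continuousWithinAt

theorem intervalIntegrable_rpow_mul_sin {α : ℝ} (hα1 : α < 1) (a b : ℝ) :
    IntervalIntegrable (fun r : ℝ => r ^ (-α) * Real.sin r) volume a b :=
  (intervalIntegral.intervalIntegrable_rpow' (by linarith)).mul_continuousOn (by fun_prop)

/-- The sine integrals `∫₀ˣ r^{-α} sin r dr` are bounded away from zero for `x ≥ 1`. -/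
theorem exists_pos_le_integral_rpow_mul_sin {α : ℝ} (hα0 : 0 < α) (hα1 : α < 1) :
    ∃ c > 0, ∀ x ≥ (1 : ℝ), c ≤ ∫ r in (0 : ℝ)..x, r ^ (-α) * Real.sin r := by
  -- Subtracting the boundary term of an integration by parts leaves the nonnegative derivative `α
  -- x^{-α-1} (1 - cos x)`. The subtracted term is itself nonnegative, so `G 1` is a lower bound for
  -- the sine integral.
  set G : ℝ → ℝ := fun x =>
    (∫ r in (0 : ℝ)..x, r ^ (-α) * Real.sin r) - x ^ (-α) * (1 - Real.cos x) with hG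
  have hcont : ContinuousOn G (Ici 0) :=
    (intervalIntegral.continuous_primitive (intervalIntegrable_rpow_mul_sin hα1) 0).continuousOn.sub
      (one_sub_cos_rpow_continuousOn hα1)
  have hderiv : ∀ x : ℝ, 0 < x → HasDerivAt G (α * x ^ (-α - 1) * (1 - Real.cos x)) x := by
    intro x hx
    have hc : ContinuousOn (fun r : ℝ => r ^ (-α) * Real.sin r) (Ioi 0) :=
      (continuousOn_id.rpow_const fun y hy => Or.inl (ne_of_gt hy)).mul (by fun_prop)
    have h1 : HasDerivAt (fun x => ∫ r in (0 : ℝ)..x, r ^ (-α) * Real.sin r)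
        (x ^ (-α) * Real.sin x) x :=
      intervalIntegral.integral_hasDerivAt_right (intervalIntegrable_rpow_mul_sin hα1 0 x)
        (hc.stronglyMeasurableAtFilter isOpen_Ioi x hx) (hc.continuousAt (Ioi_mem_nhds hx))
    have h2 : HasDerivAt (fun x : ℝ => x ^ (-α)) (-α * x ^ (-α - 1)) x :=
      Real.hasDerivAt_rpow_const (Or.inl hx.ne')
    have h3 : HasDerivAt (fun x : ℝ => 1 - Real.cos x) (Real.sin x) x := by
      simpa using (Real.hasDerivAt_cos x).const_sub 1
    exact (h1.sub (h2.mul h3)).congr_deriv (by ring)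
  have hmono : MonotoneOn G (Ici 0) := by
    refine monotoneOn_of_deriv_nonneg (convex_Ici 0) hcont ?_ ?_
    · intro x hx
      rw [interior_Ici] at hx
      exact (hderiv x hx).differentiableAt.differentiableWithinAt
    · intro x hx
      rw [interior_Ici] at hx
      rw [(hderiv x hx).deriv]
      have : 0 ≤ 1 - Real.cos x := by linarith [Real.cos_le_one x]
      have hx0 : 0 < x := hx
      positivity
  have hpos : G 0 < G 1 := by
    have hs : StrictMonoOn G (Icc 0 1) := by
      refine strictMonoOn_of_deriv_pos (convex_Icc 0 1) (hcont.mono Icc_subset_Ici_self) ?_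
      intro x hx
      rw [interior_Icc] at hx
      rw [(hderiv x hx.1).deriv]
      have : Real.cos x < 1 := by
        rw [← Real.cos_zero]
        exact Real.cos_lt_cos_of_nonneg_of_le_pi le_rfl (by linarith [Real.pi_gt_three, hx.2]) hx.1
      have h1 : 0 < 1 - Real.cos x := by linarith
      have hx0 := hx.1
      positivity
    exact hs (by simp) (by simp) one_pos
  have hG0 : G 0 = 0 := by simp [hG]
  refine ⟨G 1, by rwa [hG0] at hpos, fun x hx => ?_⟩
  have h1 : G 1 ≤ G x := hmono (by simp) (by simp only [mem_Ici]; linarith) hx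
  have h2 : 0 ≤ x ^ (-α) * (1 - Real.cos x) :=
    mul_nonneg (Real.rpow_nonneg (by linarith) _) (by linarith [Real.cos_le_one x])
  have h3 : G x = (∫ r in (0 : ℝ)..x, r ^ (-α) * Real.sin r) - x ^ (-α) * (1 - Real.cos x) := rfl
  linarith

/-- The truncated Fourier transform `∫₀ˣ k(r) e^{-ir} dr` of the fractional kernel. -/
noncomputable def kernelFourier (α x : ℝ) : ℂ :=
  ∫ r in (0 : ℝ)..x, fracKernel α r • Complex.exp (-(r * Complex.I))

theorem intervalIntegrable_fracKernel {α : ℝ} (hα1 : α < 1) (a b : ℝ) :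
    IntervalIntegrable (fracKernel α) volume a b :=
  (intervalIntegral.intervalIntegrable_rpow' (by linarith)).div_const _

theorem intervalIntegrable_fracKernel_smul_exp {α : ℝ} (hα1 : α < 1) (a b : ℝ) :
    IntervalIntegrable (fun r => fracKernel α r • Complex.exp (-(r * Complex.I))) volume a b :=
  (intervalIntegrable_fracKernel hα1 a b).smul_continuousOn (by fun_prop)

theorem continuous_kernelFourier {α : ℝ} (hα1 : α < 1) : Continuous (kernelFourier α) :=
  intervalIntegral.continuous_primitive (intervalIntegrable_fracKernel_smul_exp hα1) 0

/-- Up to sign and the Gamma factor, the imaginary part is the sine integral. This is what makes the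
limit at infinity nonzero. -/
theorem exists_pos_le_norm_kernelFourier {α : ℝ} (hα0 : 0 < α) (hα1 : α < 1) :
    ∃ c > 0, ∀ x ≥ (1 : ℝ), c ≤ ‖kernelFourier α x‖ := by
  obtain ⟨c, hc, h⟩ := exists_pos_le_integral_rpow_mul_sin hα0 hα1
  have hΓ : 0 < Real.Gamma (1 - α) := Real.Gamma_pos_of_pos (by linarith)
  refine ⟨c / Real.Gamma (1 - α), by positivity, fun x hx => ?_⟩
  have him : (kernelFourier α x).im =
      -((∫ r in (0 : ℝ)..x, r ^ (-α) * Real.sin r) / Real.Gamma (1 - α)) := by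
    have := Complex.imCLM.intervalIntegral_comp_comm
      (intervalIntegrable_fracKernel_smul_exp hα1 0 x)
    rw [kernelFourier, ← Complex.imCLM_apply, ← this, ← intervalIntegral.integral_div,
      ← intervalIntegral.integral_neg]
    refine intervalIntegral.integral_congr fun r _ => ?_
    have : (Complex.exp (-(r * Complex.I))).im = -Real.sin r := by
      have : -(r * Complex.I) = ((-r : ℝ) : ℂ) * Complex.I := by push_cast; ring
      rw [this, Complex.exp_ofReal_mul_I_im, Real.sin_neg]
    simp only [Complex.imCLM_apply, Complex.smul_im, this, fracKernel, smul_eq_mul]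
    ring
  calc c / Real.Gamma (1 - α) ≤ |(kernelFourier α x).im| := by
        rw [him, abs_neg]
        exact (div_le_div_of_nonneg_right (h x hx) hΓ.le).trans (le_abs_self _)
    _ ≤ _ := Complex.abs_im_le_norm _

theorem integrableOn_rpow_smul_exp {α : ℝ} (hα0 : 0 < α) :
    IntegrableOn (fun r : ℝ => r ^ (-α - 1) • Complex.exp (-(r * Complex.I))) (Ioi 1) := by
  have h := integrableOn_Ioi_rpow_of_lt (show -α - 1 < -1 by linarith) one_pos
  refine h.mono' ?_ ?_
  · refine ContinuousOn.aestronglyMeasurable ?_ measurableSet_Ioi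
    exact (continuousOn_id.rpow_const fun y hy =>
      Or.inl (ne_of_gt (one_pos.trans (mem_Ioi.1 hy)))).smul (by fun_prop)
  · refine (ae_restrict_iff' measurableSet_Ioi).2 (ae_of_all _ fun r hr => ?_)
    have hr0 : (0 : ℝ) ≤ r := by linarith [mem_Ioi.1 hr]
    have : -(r * Complex.I) = ((-r : ℝ) : ℂ) * Complex.I := by push_cast; ring
    rw [norm_smul, this, Complex.norm_exp_ofReal_mul_I, mul_one,
      Real.norm_of_nonneg (Real.rpow_nonneg hr0 _)]

/-- The oscillatory integrals converge as `x → ∞`. -/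
theorem exists_tendsto_kernelFourier {α : ℝ} (hα0 : 0 < α) (hα1 : α < 1) :
    ∃ l : ℂ, Tendsto (kernelFourier α) atTop (𝓝 l) := by
  set e : ℝ → ℂ := fun r => Complex.exp (-(r * Complex.I)) with he
  have hnorm : ∀ r, ‖e r‖ = 1 := fun r => by
    have : -(r * Complex.I) = ((-r : ℝ) : ℂ) * Complex.I := by push_cast; ring
    rw [he]; simp only [this, Complex.norm_exp_ofReal_mul_I]
  -- Integration by parts with primitive `I * e` improves the exponent to `-α - 1`, which is
  -- absolutely integrable on `(1, ∞)`.
  have hparts : ∀ x ≥ (1 : ℝ), ∫ r in (1 : ℝ)..x, r ^ (-α) • e r =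
      x ^ (-α) • (Complex.I * e x) - Complex.I * e 1 +
        α • (Complex.I * ∫ r in (1 : ℝ)..x, r ^ (-α - 1) • e r) := by
    intro x hx
    have hpos : ∀ r ∈ uIcc 1 x, 0 < r := fun r hr => by
      rw [uIcc_of_le hx] at hr; linarith [hr.1]
    have h1 : ∀ r ∈ uIcc 1 x, HasDerivAt (fun r : ℝ => r ^ (-α)) (-α * r ^ (-α - 1)) r :=
      fun r hr => Real.hasDerivAt_rpow_const (Or.inl (hpos r hr).ne')
    have h2 : ∀ r ∈ uIcc 1 x, HasDerivAt (fun r : ℝ => Complex.I * e r) (e r) r := by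
      intro r _
      have h : HasDerivAt (fun r : ℝ => -((r : ℂ) * Complex.I)) (-(1 * Complex.I)) r :=
        ((Complex.ofRealCLM.hasDerivAt (x := r)).mul_const Complex.I).neg
      refine (h.cexp.const_mul Complex.I).congr_deriv ?_
      linear_combination (-e r) * Complex.I_mul_I
    have h3 := intervalIntegral.integral_smul_deriv_eq_deriv_smul h1 h2
      (ContinuousOn.intervalIntegrable (by
        exact continuousOn_const.mul
          (continuousOn_id.rpow_const fun r hr => Or.inl (hpos r hr).ne')))
      (Continuous.intervalIntegrable (by fun_prop) _ _)
    rw [h3, Real.one_rpow, one_smul, sub_eq_add_neg _ (∫ r in (1 : ℝ)..x, _),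
      ← intervalIntegral.integral_neg, ← intervalIntegral.integral_const_mul,
      ← intervalIntegral.integral_smul]
    congr 1
    refine intervalIntegral.integral_congr fun r _ => ?_
    simp only [Complex.real_smul]
    push_cast; ring
  have hlim1 : Tendsto (fun x : ℝ => x ^ (-α) • (Complex.I * e x)) atTop (𝓝 0) := by
    refine squeeze_zero_norm' ?_ (tendsto_rpow_neg_atTop hα0)
    filter_upwards [eventually_ge_atTop 0] with x hx
    rw [norm_smul, norm_mul, Complex.norm_I, hnorm, one_mul, mul_one,
      Real.norm_of_nonneg (Real.rpow_nonneg hx _)]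
  have hlim2 := intervalIntegral_tendsto_integral_Ioi (1 : ℝ) (integrableOn_rpow_smul_exp hα0)
    tendsto_id
  have hlim3 := ((hlim1.sub_const (Complex.I * e 1)).add ((hlim2.const_mul Complex.I).const_smul α))
  refine ⟨_, (((hlim3.const_smul (Real.Gamma (1 - α))⁻¹).const_add (kernelFourier α 1))).congr' ?_⟩
  filter_upwards [eventually_ge_atTop 1] with x hx
  simp only [id]
  rw [← hparts x hx, kernelFourier, kernelFourier,
    ← intervalIntegral.integral_add_adjacent_intervals
      (intervalIntegrable_fracKernel_smul_exp hα1 0 1)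
      (intervalIntegrable_fracKernel_smul_exp hα1 1 x), ← intervalIntegral.integral_smul]
  congr 1
  refine intervalIntegral.integral_congr fun r _ => ?_
  simp only [fracKernel, smul_smul, he]
  congr 1; ring

/-- Convergence controls large `x`, and continuity on a compact interval the rest. The bound
supplies the majorant for dominated convergence. -/
theorem exists_norm_kernelFourier_le {α : ℝ} (hα0 : 0 < α) (hα1 : α < 1) :
    ∃ C, ∀ x ≥ (0 : ℝ), ‖kernelFourier α x‖ ≤ C := by
  obtain ⟨l, hl⟩ := exists_tendsto_kernelFourier hα0 hα1
  obtain ⟨X, hX⟩ := eventually_atTop.1 (hl.norm.eventually_lt_const (lt_add_one ‖l‖))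
  obtain ⟨C, hC⟩ := (isCompact_Icc (a := (0 : ℝ)) (b := X)).exists_bound_of_continuousOn
    (continuous_kernelFourier hα1).continuousOn
  refine ⟨max C (‖l‖ + 1), fun x hx => ?_⟩
  rcases le_total x X with h | h
  · exact (hC x ⟨hx, h⟩).trans (le_max_left _ _)
  · exact (hX x h).le.trans (le_max_right _ _)

end OscillatoryIntegral

/-! ### Dyadic sums with a rising and a falling regime. -/

section LacunarySums

/-- Partial sums of `min (x^{1-β}) (x^{-β})` along a dyadic sequence are uniformly bounded. -/
theorem exists_sum_dyadic_min_le {β : ℝ} (hβ0 : 0 < β) (hβ1 : β < 1) :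
    ∃ C, ∀ r > (0 : ℝ), ∀ n : ℕ,
      ∑ k ∈ Finset.range n, min ((2 ^ k * r) ^ (1 - β)) ((2 ^ k * r) ^ (-β)) ≤ C := by
  set p : ℝ := 2 ^ (1 - β) with hp
  set q : ℝ := 2 ^ (-β) with hq
  have hp1 : 1 < p := Real.one_lt_rpow one_lt_two (by linarith)
  have hq1 : q < 1 := Real.rpow_lt_one_of_one_lt_of_neg one_lt_two (by linarith)
  have hq0 : 0 < q := by positivity
  set A : ℝ := (p - 1)⁻¹ with hA
  set D : ℝ := (1 - q)⁻¹ with hD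
  have hA0 : 0 < A := inv_pos.2 (by linarith)
  have hD0 : 0 < D := inv_pos.2 (by linarith)
  have hAe : A * p = A + 1 := by
    have : A * (p - 1) = 1 := inv_mul_cancel₀ (by linarith)
    linarith
  have hDe : D * q = D - 1 := by
    have : D * (1 - q) = 1 := inv_mul_cancel₀ (by linarith)
    linarith
  refine ⟨D + A * p, fun r hr n => ?_⟩
  -- The terms grow by the ratio `p` while `2 ^ k * r ≤ 1` and shrink by `q` afterwards. The
  -- identities `A * p = A + 1` and `D * q = D - 1` make both bounds telescope; `A * p` pays for the
  -- whole rising part.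
  have key : ∀ n : ℕ, (2 ^ n * r ≤ 1 →
      ∑ k ∈ Finset.range n, min ((2 ^ k * r) ^ (1 - β)) ((2 ^ k * r) ^ (-β)) ≤
        A * (2 ^ n * r) ^ (1 - β)) ∧ (1 < 2 ^ n * r →
      ∑ k ∈ Finset.range n, min ((2 ^ k * r) ^ (1 - β)) ((2 ^ k * r) ^ (-β)) ≤
        D + A * p - D * (2 ^ n * r) ^ (-β)) := by
    intro n
    induction n with
    | zero =>
      simp only [Finset.range_zero, Finset.sum_empty, pow_zero, one_mul]
      refine ⟨fun _ => by positivity, fun h => ?_⟩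
      have : r ^ (-β) ≤ 1 := Real.rpow_le_one_of_one_le_of_nonpos h.le (by linarith)
      nlinarith [mul_pos hA0 (one_pos.trans hp1)]
    | succ n ih =>
      rw [Finset.sum_range_succ, pow_succ]
      set x : ℝ := 2 ^ n * r with hx
      have hx0 : 0 < x := by positivity
      have e1 : 2 ^ n * 2 * r = 2 * x := by rw [hx]; ring
      have e2 : (2 * x) ^ (1 - β) = p * x ^ (1 - β) := Real.mul_rpow (by norm_num) hx0.le
      have e3 : (2 * x) ^ (-β) = q * x ^ (-β) := Real.mul_rpow (by norm_num) hx0.le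
      rw [e1]
      have hm1 : min (x ^ (1 - β)) (x ^ (-β)) ≤ x ^ (1 - β) := min_le_left _ _
      have hm2 : min (x ^ (1 - β)) (x ^ (-β)) ≤ x ^ (-β) := min_le_right _ _
      have e4 : A * (p * x ^ (1 - β)) = A * x ^ (1 - β) + x ^ (1 - β) := by
        rw [← mul_assoc, hAe]; ring
      refine ⟨fun h => ?_, fun h => ?_⟩
      · have := ih.1 (by linarith)
        rw [e2]; linarith
      · rcases le_or_gt x 1 with h1 | h1
        · have := ih.1 h1
          have h5 : x ^ (1 - β) ≤ 1 := Real.rpow_le_one hx0.le h1 (by linarith)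
          have h6 : (2 * x) ^ (-β) ≤ 1 := Real.rpow_le_one_of_one_le_of_nonpos h.le (by linarith)
          have h7 : A * (p * x ^ (1 - β)) ≤ A * p := by
            rw [← mul_assoc]; exact mul_le_of_le_one_right (by positivity) h5
          nlinarith
        · have := ih.2 h1
          have e5 : D * (q * x ^ (-β)) = D * x ^ (-β) - x ^ (-β) := by
            rw [← mul_assoc, hDe]; ring
          rw [e3]; linarith
  rcases le_or_gt (2 ^ n * r) 1 with h | h
  · have h5 : (2 ^ n * r) ^ (1 - β) ≤ 1 := Real.rpow_le_one (by positivity) h (by linarith)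
    have := (key n).1 h
    nlinarith
  · have := (key n).2 h
    have : 0 < D * (2 ^ n * r) ^ (-β) := by positivity
    linarith

end LacunarySums

/-! ### Testing the coordinate equations against exponentials. -/

section Testing

theorem intervalIntegral_congr_ae_Ioo {E : Type*} [NormedAddCommGroup E] [NormedSpace ℝ E]
    {f g : ℝ → E} {b : ℝ} (hb : 0 ≤ b) (h : ∀ᵐ t ∂volume.restrict (Ioo 0 b), f t = g t) :
    ∫ t in (0 : ℝ)..b, f t = ∫ t in (0 : ℝ)..b, g t := by
  rw [intervalIntegral.integral_of_le hb, intervalIntegral.integral_of_le hb,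
    integral_Ioc_eq_integral_Ioo, integral_Ioc_eq_integral_Ioo]
  exact integral_congr_ae h

theorem norm_exp_neg_mul_I (r : ℝ) : ‖Complex.exp (-(r * Complex.I))‖ = 1 := by
  have : -(r * Complex.I) = ((-r : ℝ) : ℂ) * Complex.I := by push_cast; ring
  rw [this, Complex.norm_exp_ofReal_mul_I]

/-- The primitive `∫₀ˣ e^{-ir} dr`. -/
noncomputable def expPrimitive (x : ℝ) : ℂ := ∫ r in (0 : ℝ)..x, Complex.exp (-(r * Complex.I))

theorem continuous_expPrimitive : Continuous expPrimitive :=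
  intervalIntegral.continuous_primitive
    (fun _ _ => Continuous.intervalIntegrable (by fun_prop) _ _) 0

theorem norm_expPrimitive_le (x : ℝ) : ‖expPrimitive x‖ ≤ 2 := by
  have h := integral_exp_mul_complex (a := 0) (b := x) (neg_ne_zero.2 Complex.I_ne_zero)
  have h2 : expPrimitive x = ∫ r in (0 : ℝ)..x, Complex.exp (-Complex.I * r) := by
    refine intervalIntegral.integral_congr fun r _ => ?_
    ring_nf
  rw [h2, h, norm_div, norm_neg, Complex.norm_I, div_one]
  refine (norm_sub_le _ _).trans ?_
  have h3 : ∀ y : ℝ, ‖Complex.exp (-Complex.I * y)‖ = 1 := fun y => by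
    rw [← norm_exp_neg_mul_I y]; ring_nf
  rw [h3, h3]; norm_num

/-- The kernel is homogeneous, `k(r) = ω^α k(ωr)`, and the factor `ω` absorbs the Jacobian of the
rescaling. The remaining `ω^α` matches the coefficient of `v` in the scalar equation. -/
theorem mul_integral_fracKernel_smul_exp {α ω c : ℝ} (hω : 0 < ω) (hc : 0 ≤ c) (s : ℝ) :
    (ω : ℂ) * ∫ r in (0 : ℝ)..c, fracKernel α r • Complex.exp (-((ω * (s + r) : ℝ) * Complex.I)) =
      (ω ^ α : ℝ) * Complex.exp (-((ω * s : ℝ) * Complex.I)) * kernelFourier α (ω * c) := by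
  have h := intervalIntegral.integral_comp_mul_left (a := 0) (b := c)
    (fun r => fracKernel α r • Complex.exp (-(r * Complex.I))) hω.ne'
  rw [mul_zero] at h
  have h2 : kernelFourier α (ω * c) = ω • ∫ r in (0 : ℝ)..c,
      fracKernel α (ω * r) • Complex.exp (-((ω * r : ℝ) * Complex.I)) := by
    rw [h, smul_smul, mul_inv_cancel₀ hω.ne', one_smul]; rfl
  rw [h2, Complex.real_smul, mul_left_comm]
  congr 1
  rw [← intervalIntegral.integral_const_mul]
  refine intervalIntegral.integral_congr fun r hr => ?_
  rw [uIcc_of_le hc] at hr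
  have h3 : fracKernel α r = ω ^ α * fracKernel α (ω * r) := by
    rw [fracKernel, fracKernel, Real.mul_rpow hω.le hr.1, Real.rpow_neg hω.le]
    have : ω ^ α ≠ 0 := (Real.rpow_pos_of_pos hω _).ne'
    field_simp
  have h4 : Complex.exp (-((ω * (s + r) : ℝ) * Complex.I)) =
      Complex.exp (-((ω * s : ℝ) * Complex.I)) * Complex.exp (-((ω * r : ℝ) * Complex.I)) := by
    rw [← Complex.exp_add]; congr 1; push_cast; ring
  simp only [h3, h4, Complex.real_smul]
  push_cast; ring

theorem mul_integral_exp {ω : ℝ} (hω : 0 < ω) (c s : ℝ) :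
    (ω : ℂ) * ∫ r in (0 : ℝ)..c, (1 : ℝ) • Complex.exp (-((ω * (s + r) : ℝ) * Complex.I)) =
      Complex.exp (-((ω * s : ℝ) * Complex.I)) * expPrimitive (ω * c) := by
  have h := intervalIntegral.integral_comp_mul_left (a := 0) (b := c)
    (fun r : ℝ => Complex.exp (-(r * Complex.I))) hω.ne'
  rw [mul_zero] at h
  have h2 : expPrimitive (ω * c) = ω • ∫ r in (0 : ℝ)..c,
      Complex.exp (-((ω * r : ℝ) * Complex.I)) := by
    rw [h, smul_smul, mul_inv_cancel₀ hω.ne', one_smul]; rfl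
  rw [h2, Complex.real_smul, mul_left_comm]
  congr 1
  rw [← intervalIntegral.integral_const_mul]
  refine intervalIntegral.integral_congr fun r _ => ?_
  have h4 : Complex.exp (-((ω * (s + r) : ℝ) * Complex.I)) =
      Complex.exp (-((ω * s : ℝ) * Complex.I)) * Complex.exp (-((ω * r : ℝ) * Complex.I)) := by
    rw [← Complex.exp_add]; congr 1; push_cast; ring
  simp only [h4, one_smul]

/-- The scalar equation `∂ₜ^α v = -h`, `h = ω^α v + ε u e^{iωt}`, tested against `ω e^{-iωt}` on
`(0, b)`. -/
theorem tested_equation {α b ω : ℝ} (hα1 : α < 1) (hb : 0 ≤ b) (hω : 0 < ω)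
    {u v h : ℝ → ℂ} {ε : ℂ}
    (hu : IntegrableOn u (Ioo 0 b)) (hv : IntegrableOn v (Ioo 0 b)) (hh : IntegrableOn h (Ioo 0 b))
    (hconv : ∀ᵐ t ∂volume.restrict (Ioo 0 b),
      ∫ s in (0 : ℝ)..t, fracKernel α (t - s) • v s = -∫ s in (0 : ℝ)..t, h s)
    (heq : ∀ᵐ t ∂volume.restrict (Ioo 0 b),
      h t = (ω ^ α : ℝ) * v t + ε * (u t * Complex.exp ((ω * t : ℝ) * Complex.I))) :
    ε * ∫ s in (0 : ℝ)..b, u s * kernelFourier α (ω * (b - s)) =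
      ∫ s in (0 : ℝ)..b, h s * (Complex.exp (-((ω * s : ℝ) * Complex.I)) *
        (kernelFourier α (ω * (b - s)) + expPrimitive (ω * (b - s)))) := by
  set e : ℝ → ℂ := fun t => Complex.exp (-((ω * t : ℝ) * Complex.I)) with he
  have hec : Continuous e := by fun_prop
  have hen : ∀ t, ‖e t‖ ≤ 1 := fun t => (norm_exp_neg_mul_I _).le
  have hF : Continuous (fun s => kernelFourier α (ω * (b - s))) :=
    (continuous_kernelFourier hα1).comp (by fun_prop)
  have hP : Continuous (fun s => expPrimitive (ω * (b - s))) :=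
    continuous_expPrimitive.comp (by fun_prop)
  have hk : IntegrableOn (fracKernel α) (Ioo 0 b) :=
    (intervalIntegrable_iff_integrableOn_Ioo_of_le hb).1 (intervalIntegrable_fracKernel hα1 0 b)
  have h1 : IntegrableOn (fun _ => (1 : ℝ)) (Ioo 0 b) := integrableOn_const (by simp)
  have L := integral_convolution_mul hb hk hv hec hen
  have R := integral_convolution_mul hb h1 hh hec hen
  have hLR : ∫ t in (0 : ℝ)..b, (∫ s in (0 : ℝ)..t, fracKernel α (t - s) • v s) * e t =
      -∫ t in (0 : ℝ)..b, (∫ s in (0 : ℝ)..t, (1 : ℝ) • h s) * e t := by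
    rw [← intervalIntegral.integral_neg]
    refine intervalIntegral_congr_ae_Ioo hb ?_
    filter_upwards [hconv] with t ht
    simp only [ht, one_smul, neg_mul]
  rw [L, R] at hLR
  have hLR2 := congrArg (fun z => (ω : ℂ) * z) hLR
  beta_reduce at hLR2
  rw [mul_neg, ← intervalIntegral.integral_const_mul, ← intervalIntegral.integral_const_mul] at hLR2
  -- Here `v` is eliminated: it appears only as `ω^α v`, which is `h - ε u e^{iωs}`. The test
  -- exponential cancels the oscillation of the forcing term.
  have eL : ∫ s in (0 : ℝ)..b, (ω : ℂ) * (v s * ∫ r in (0 : ℝ)..(b - s), fracKernel α r • e (s + r))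
      = ∫ s in (0 : ℝ)..b, (h s * (e s * kernelFourier α (ω * (b - s))) -
          ε * (u s * kernelFourier α (ω * (b - s)))) := by
    refine intervalIntegral_congr_ae_Ioo hb ?_
    filter_upwards [heq, ae_restrict_mem measurableSet_Ioo] with s hs hsb
    rw [mul_left_comm, mul_integral_fracKernel_smul_exp hω (by linarith [hsb.2]), hs]
    have : Complex.exp ((ω * s : ℝ) * Complex.I) * e s = 1 := by
      rw [he, ← Complex.exp_add, add_neg_cancel, Complex.exp_zero]
    linear_combination (-ε * u s * kernelFourier α (ω * (b - s))) * this
  have eR : ∫ s in (0 : ℝ)..b, (ω : ℂ) * (h s * ∫ r in (0 : ℝ)..(b - s), (1 : ℝ) • e (s + r))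
      = ∫ s in (0 : ℝ)..b, h s * (e s * expPrimitive (ω * (b - s))) := by
    refine intervalIntegral.integral_congr fun s _ => ?_
    simp only [he]
    rw [mul_left_comm, mul_integral_exp hω]
  have hhi : IntervalIntegrable h volume 0 b :=
    (intervalIntegrable_iff_integrableOn_Ioo_of_le hb).2 hh
  have hui : IntervalIntegrable u volume 0 b :=
    (intervalIntegrable_iff_integrableOn_Ioo_of_le hb).2 hu
  have i1 : IntervalIntegrable (fun s => h s * (e s * kernelFourier α (ω * (b - s)))) volume 0 b :=
    hhi.mul_continuousOn (hec.mul hF).continuousOn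
  have i2 : IntervalIntegrable (fun s => h s * (e s * expPrimitive (ω * (b - s)))) volume 0 b :=
    hhi.mul_continuousOn (hec.mul hP).continuousOn
  have i3 : IntervalIntegrable (fun s => ε * (u s * kernelFourier α (ω * (b - s)))) volume 0 b :=
    (hui.mul_continuousOn hF.continuousOn).const_mul ε
  rw [eL, eR, intervalIntegral.integral_sub i1 i3] at hLR2
  simp only [mul_add]
  rw [intervalIntegral.integral_add i1 i2, ← intervalIntegral.integral_const_mul]
  linear_combination -hLR2

/-- If the components `h k` tend to zero, the driving function `u` vanishes. -/
theorem ae_eq_zero_of_tendsto_components {α τ : ℝ} (hα0 : 0 < α) (hα1 : α < 1)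
    {ω : ℕ → ℝ} (hω : ∀ k, 0 < ω k) (hωlim : Tendsto ω atTop atTop)
    {u : ℝ → ℂ} {v h : ℕ → ℝ → ℂ} {ε : ℂ} (hε : ε ≠ 0) {B : ℝ → ℝ}
    (hu : IntegrableOn u (Ioo 0 τ)) (hv : ∀ k, IntegrableOn (v k) (Ioo 0 τ))
    (hh : ∀ k, IntegrableOn (h k) (Ioo 0 τ)) (hB : IntegrableOn B (Ioo 0 τ))
    (hhB : ∀ k t, ‖h k t‖ ≤ B t) (hlim : ∀ t, Tendsto (fun k => h k t) atTop (𝓝 0))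
    (hconv : ∀ k, ∀ᵐ t ∂volume.restrict (Ioo 0 τ),
      ∫ s in (0 : ℝ)..t, fracKernel α (t - s) • v k s = -∫ s in (0 : ℝ)..t, h k s)
    (heq : ∀ k, ∀ᵐ t ∂volume.restrict (Ioo 0 τ),
      h k t = (ω k ^ α : ℝ) * v k t + ε * (u t * Complex.exp ((ω k * t : ℝ) * Complex.I))) :
    ∀ᵐ t ∂volume.restrict (Ioo 0 τ), u t = 0 := by
  obtain ⟨l, hl⟩ := exists_tendsto_kernelFourier hα0 hα1
  obtain ⟨c, hc, hcle⟩ := exists_pos_le_norm_kernelFourier hα0 hα1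
  obtain ⟨C, hC⟩ := exists_norm_kernelFourier_le hα0 hα1
  have hl0 : l ≠ 0 := by
    have : c ≤ ‖l‖ := ge_of_tendsto hl.norm (by
      filter_upwards [eventually_ge_atTop 1] with x hx using hcle x hx)
    exact norm_pos_iff.1 (hc.trans_le this)
  have hzero : ∀ b ∈ Ioo 0 τ, ∫ s in (0 : ℝ)..b, u s = 0 := by
    intro b hb
    have hsub : Ioo 0 b ⊆ Ioo 0 τ := Ioo_subset_Ioo_right hb.2.le
    have hμ : volume.restrict (Ioo 0 b) ≤ volume.restrict (Ioo 0 τ) :=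
      Measure.restrict_mono hsub le_rfl
    have hui : IntervalIntegrable u volume 0 b :=
      (intervalIntegrable_iff_integrableOn_Ioo_of_le hb.1.le).2 (hu.mono_set hsub)
    have hBi : IntervalIntegrable B volume 0 b :=
      (intervalIntegrable_iff_integrableOn_Ioo_of_le hb.1.le).2 (hB.mono_set hsub)
    have hFc : ∀ k, Continuous (fun s => kernelFourier α (ω k * (b - s))) := fun k =>
      (continuous_kernelFourier hα1).comp (by fun_prop)
    have hPc : ∀ k, Continuous (fun s => expPrimitive (ω k * (b - s))) := fun k =>
      continuous_expPrimitive.comp (by fun_prop)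
    have hFb : ∀ k, ∀ s ∈ uIoc 0 b, ‖kernelFourier α (ω k * (b - s))‖ ≤ C := fun k s hs => by
      rw [uIoc_of_le hb.1.le] at hs
      exact hC _ (mul_nonneg (hω k).le (by linarith [hs.2]))
    have lim1 : Tendsto (fun k => ∫ s in (0 : ℝ)..b, u s * kernelFourier α (ω k * (b - s))) atTop
        (𝓝 (∫ s in (0 : ℝ)..b, u s * l)) := by
      refine intervalIntegral.tendsto_integral_filter_of_dominated_convergence
        (fun s => ‖u s‖ * C) (Eventually.of_forall fun k => ?_) (Eventually.of_forall fun k => ?_)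
        (hui.norm.mul_const C) ?_
      · exact (intervalIntegrable_iff.1
          (hui.mul_continuousOn (hFc k).continuousOn)).aestronglyMeasurable
      · refine ae_of_all _ fun s hs => ?_
        rw [norm_mul]
        exact mul_le_mul_of_nonneg_left (hFb k s hs) (norm_nonneg _)
      -- At `s = b` the argument `ω k * (b - s)` stays at `0` instead of tending to infinity.
      · have hne : ∀ᵐ s : ℝ, s ≠ b := by simp [ae_iff, measure_singleton]
        filter_upwards [hne] with s hsb hs
        rw [uIoc_of_le hb.1.le] at hs
        have hpos : 0 < b - s := sub_pos.2 (lt_of_le_of_ne hs.2 hsb)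
        exact (hl.comp (hωlim.atTop_mul_const hpos)).const_mul (u s)
    have lim2 : Tendsto (fun k => ∫ s in (0 : ℝ)..b, h k s *
        (Complex.exp (-((ω k * s : ℝ) * Complex.I)) *
          (kernelFourier α (ω k * (b - s)) + expPrimitive (ω k * (b - s))))) atTop
        (𝓝 (∫ s in (0 : ℝ)..b, (0 : ℂ))) := by
      have hbd : ∀ k, ∀ s ∈ uIoc 0 b, ‖Complex.exp (-((ω k * s : ℝ) * Complex.I)) *
          (kernelFourier α (ω k * (b - s)) + expPrimitive (ω k * (b - s)))‖ ≤ C + 2 := by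
        intro k s hs
        rw [norm_mul, norm_exp_neg_mul_I, one_mul]
        exact (norm_add_le _ _).trans (add_le_add (hFb k s hs) (norm_expPrimitive_le _))
      refine intervalIntegral.tendsto_integral_filter_of_dominated_convergence
        (fun s => B s * (C + 2)) (Eventually.of_forall fun k => ?_)
        (Eventually.of_forall fun k => ?_) (hBi.mul_const _) ?_
      · have hhi : IntervalIntegrable (h k) volume 0 b :=
          (intervalIntegrable_iff_integrableOn_Ioo_of_le hb.1.le).2 ((hh k).mono_set hsub)
        refine (intervalIntegrable_iff.1
          (hhi.mul_continuousOn (Continuous.continuousOn ?_))).aestronglyMeasurable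
        exact Continuous.mul (by fun_prop) ((hFc k).add (hPc k))
      · refine ae_of_all _ fun s hs => ?_
        rw [norm_mul]
        exact mul_le_mul (hhB k s) (hbd k s hs) (norm_nonneg _) ((norm_nonneg _).trans (hhB k s))
      · refine ae_of_all _ fun s hs => ?_
        have h0 : Tendsto (fun k => ‖h k s‖ * (C + 2)) atTop (𝓝 0) := by
          simpa using (hlim s).norm.mul_const (C + 2)
        refine squeeze_zero_norm (fun k => ?_) h0
        rw [norm_mul]
        exact mul_le_mul_of_nonneg_left (hbd k s hs) (norm_nonneg _)
    have lim3 := lim1.const_mul ε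
    have hfun : ∀ k, ε * ∫ s in (0 : ℝ)..b, u s * kernelFourier α (ω k * (b - s)) = _ := fun k =>
      tested_equation hα1 hb.1.le (hω k) (hu.mono_set hsub) ((hv k).mono_set hsub)
        ((hh k).mono_set hsub) (ae_mono hμ (hconv k)) (ae_mono hμ (heq k))
    simp only [hfun] at lim3
    have h0 := tendsto_nhds_unique lim3 lim2
    rw [intervalIntegral.integral_zero, intervalIntegral.integral_mul_const] at h0
    simpa [hε, hl0] using h0
  rcases le_or_gt τ 0 with hτ | hτ
  · simp [Ioo_eq_empty (not_lt.2 hτ)]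
  have hui : IntervalIntegrable u volume 0 τ :=
    (intervalIntegrable_iff_integrableOn_Ioo_of_le hτ.le).2 hu
  rw [ae_restrict_iff' measurableSet_Ioo]
  -- Lebesgue differentiation of a primitive that vanishes identically on `(0, τ)`.
  filter_upwards [hui.ae_hasDerivAt_integral] with t ht htτ
  have h1 := ht (by rw [uIcc_of_le hτ.le]; exact Ioo_subset_Icc_self htτ) 0 left_mem_uIcc
  have h2 : HasDerivAt (fun x => ∫ s in (0 : ℝ)..x, u s) 0 t :=
    (hasDerivAt_const t (0 : ℂ)).congr_of_eventuallyEq (by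
      filter_upwards [isOpen_Ioo.mem_nhds htτ] with x hx using hzero x hx)
  exact h1.unique h2

end Testing

/-! ### The counterexample for an abstract dyadic orthonormal system. -/

section AbstractCounterexample

/-- The weights `1, 1, 2^α, 4^α, …`. -/
noncomputable def dyadicWeight (α : ℝ) (n : ℕ) : ℝ := ((2 : ℝ) ^ (n - 1)) ^ α

theorem dyadicWeight_pos (α : ℝ) (n : ℕ) : 0 < dyadicWeight α n := by
  unfold dyadicWeight; positivity

theorem one_le_dyadicWeight {α : ℝ} (hα : 0 ≤ α) (n : ℕ) : 1 ≤ dyadicWeight α n :=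
  Real.one_le_rpow (one_le_pow₀ one_le_two) hα

theorem dyadicWeight_mono {α : ℝ} (hα : 0 ≤ α) : Monotone (dyadicWeight α) := fun m n h =>
  Real.rpow_le_rpow (by positivity) (pow_le_pow_right₀ one_le_two (by omega)) hα

variable {V H : Type*}
  [NormedAddCommGroup V] [InnerProductSpace ℂ V]
  [NormedAddCommGroup H] [InnerProductSpace ℂ H]

/-- `b` is a sequence of vectors of `V` which is orthonormal in `H`, such that `V`-inner products
with `b n` are `dyadicWeight α n` times the `H`-inner products. -/
structure IsDyadicSystem (α : ℝ) (j : V →L[ℂ] H) (b : ℕ → V) : Prop where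
  orthonormal : Orthonormal ℂ fun n => j (b n)
  inner_eq : ∀ n u, inner ℂ (b n) u = (dyadicWeight α n : ℂ) * inner ℂ (j (b n)) (j u)

namespace IsDyadicSystem

variable {α : ℝ} {j : V →L[ℂ] H} {b : ℕ → V}

theorem inner_self (hb : IsDyadicSystem α j b) (n : ℕ) :
    inner ℂ (b n) (b n) = (dyadicWeight α n : ℂ) := by
  have : inner ℂ (j (b n)) (j (b n)) = (1 : ℂ) := by
    rw [inner_self_eq_norm_sq_to_K, hb.orthonormal.1 n]; simp
  rw [hb.inner_eq, this, mul_one]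

theorem inner_of_ne (hb : IsDyadicSystem α j b) {m n : ℕ} (h : m ≠ n) :
    inner ℂ (b m) (b n) = (0 : ℂ) := by
  rw [hb.inner_eq, hb.orthonormal.2 h, mul_zero]

theorem norm_sq (hb : IsDyadicSystem α j b) (n : ℕ) : ‖b n‖ ^ 2 = dyadicWeight α n := by
  rw [← inner_self_eq_norm_sq (𝕜 := ℂ), hb.inner_self]
  exact Complex.ofReal_re _

theorem norm_eq (hb : IsDyadicSystem α j b) (k : ℕ) :
    ‖b (k + 1)‖ = ((2 : ℝ) ^ k) ^ (α / 2) := by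
  have h2 : (((2 : ℝ) ^ k) ^ (α / 2)) ^ 2 = dyadicWeight α (k + 1) := by
    rw [dyadicWeight, Nat.add_sub_cancel, ← Real.rpow_natCast, ← Real.rpow_mul (by positivity)]
    norm_num
  exact (sq_eq_sq₀ (norm_nonneg _) (by positivity)).1 ((hb.norm_sq _).trans h2.symm)

theorem norm_zero (hb : IsDyadicSystem α j b) : ‖b 0‖ = 1 := by
  have h1 : ‖b 0‖ ^ 2 = 1 := by rw [hb.norm_sq]; simp [dyadicWeight]
  nlinarith [norm_nonneg (b 0)]

end IsDyadicSystem

theorem norm_exp_sub_exp_le (x y : ℝ) :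
    ‖Complex.exp (x * Complex.I) - Complex.exp (y * Complex.I)‖ ≤ min 2 |x - y| := by
  refine le_min ((norm_sub_le _ _).trans ?_) ?_
  · rw [Complex.norm_exp_ofReal_mul_I, Complex.norm_exp_ofReal_mul_I]; norm_num
  · have h : Complex.exp (x * Complex.I) - Complex.exp (y * Complex.I) =
        Complex.exp (y * Complex.I) * (Complex.exp (Complex.I * (x - y : ℝ)) - 1) := by
      rw [mul_sub, ← Complex.exp_add, mul_one]; congr 2; push_cast; ring
    rw [h, norm_mul, Complex.norm_exp_ofReal_mul_I, one_mul]
    exact Real.norm_exp_I_mul_ofReal_sub_one_le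

/-- The summands of the lacunary series `∑ₖ 2^{-αk} e^{i 2^k t} b_{k+1}`. -/
noncomputable def lacunaryTerm (α : ℝ) (b : ℕ → V) (t : ℝ) (k : ℕ) : V :=
  (((((2 : ℝ) ^ k) ^ (-α) : ℝ) : ℂ) * Complex.exp (((2 : ℝ) ^ k * t : ℝ) * Complex.I)) • b (k + 1)

section Lacunary

variable {α : ℝ} {j : V →L[ℂ] H} {b : ℕ → V}

theorem norm_lacunaryTerm (hb : IsDyadicSystem α j b) (t : ℝ) (k : ℕ) :
    ‖lacunaryTerm α b t k‖ = ((2 : ℝ) ^ (-(α / 2))) ^ k := by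
  have h2 : (0 : ℝ) < 2 ^ k := by positivity
  rw [lacunaryTerm, norm_smul, norm_mul, Complex.norm_exp_ofReal_mul_I, mul_one, hb.norm_eq,
    Complex.norm_real, Real.norm_of_nonneg (by positivity), ← Real.rpow_add h2,
    ← Real.rpow_natCast, ← Real.rpow_natCast, ← Real.rpow_mul (by norm_num),
    ← Real.rpow_mul (by norm_num)]
  congr 1; ring

/-- With `x = 2^k |t - s|`, the exponentials differ by at most `min 2 x`, and the coefficient times
the norm of the vector is `2^{-kα/2} = |t - s|^{α/2} x^{-α/2}`. Factoring out the Hölder modulus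
leaves a summand of the dyadic sum with `β = α / 2`. -/
theorem norm_lacunaryTerm_sub_le (hb : IsDyadicSystem α j b) {t s : ℝ} (hts : t ≠ s) (k : ℕ) :
    ‖lacunaryTerm α b t k - lacunaryTerm α b s k‖ ≤ 2 * |t - s| ^ (α / 2) *
      min ((2 ^ k * |t - s|) ^ (1 - α / 2)) ((2 ^ k * |t - s|) ^ (-(α / 2))) := by
  have hr : 0 < |t - s| := abs_pos.2 (sub_ne_zero.2 hts)
  have h2 : (0 : ℝ) < 2 ^ k := by positivity
  set r := |t - s| with hrdef
  set x := (2 : ℝ) ^ k * r with hx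
  have hx0 : 0 < x := by positivity
  have hexp := norm_exp_sub_exp_le (2 ^ k * t) (2 ^ k * s)
  rw [← mul_sub, abs_mul, abs_of_pos h2, ← hrdef, ← hx] at hexp
  rw [lacunaryTerm, lacunaryTerm, ← sub_smul, ← mul_sub, norm_smul, norm_mul, hb.norm_eq,
    Complex.norm_real, Real.norm_of_nonneg (by positivity)]
  have e1 : ((2 : ℝ) ^ k) ^ (-α) * ((2 : ℝ) ^ k) ^ (α / 2) = r ^ (α / 2) * x ^ (-(α / 2)) := by
    rw [← Real.rpow_add h2, hx, Real.mul_rpow h2.le hr.le, mul_left_comm, ← Real.rpow_add hr]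
    simp only [add_neg_cancel, Real.rpow_zero, mul_one]
    congr 1; ring
  have e2 : x ^ (1 - α / 2) = x ^ (-(α / 2)) * x := by
    rw [show 1 - α / 2 = -(α / 2) + 1 by ring, Real.rpow_add hx0, Real.rpow_one]
  have hm : min 2 x ≤ 2 * min x 1 := by
    rcases le_total x 1 with h | h
    · rw [min_eq_left h]; exact (min_le_right _ _).trans (by linarith)
    · rw [min_eq_right h]; exact (min_le_left _ _).trans (by linarith)
  have hy : 0 < x ^ (-(α / 2)) := by positivity
  calc _ = r ^ (α / 2) * x ^ (-(α / 2)) *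
        ‖Complex.exp ((2 ^ k * t : ℝ) * Complex.I) - Complex.exp ((2 ^ k * s : ℝ) * Complex.I)‖ := by
        rw [← e1]; ring
    _ ≤ r ^ (α / 2) * x ^ (-(α / 2)) * (2 * min x 1) := by
        gcongr; exact hexp.trans hm
    _ = 2 * r ^ (α / 2) * min (x ^ (1 - α / 2)) (x ^ (-(α / 2))) := by
        rw [e2]
        nth_rewrite 3 [← mul_one (x ^ (-(α / 2)))]
        rw [← mul_min_of_nonneg _ _ hy.le]; ring

theorem inner_lacunaryTerm_of_ne (hb : IsDyadicSystem α j b) (t : ℝ) {n k : ℕ} (h : n ≠ k + 1) :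
    inner ℂ (b n) (lacunaryTerm α b t k) = (0 : ℂ) := by
  rw [lacunaryTerm, inner_smul_right, hb.inner_of_ne h, mul_zero]

/-- The coefficient `2^{-αk}` exactly cancels `‖b (k+1)‖_V² = 2^{αk}`, so the forcing in each
coordinate has constant amplitude. -/
theorem inner_lacunaryTerm_self (hb : IsDyadicSystem α j b) (t : ℝ) (k : ℕ) :
    inner ℂ (b (k + 1)) (lacunaryTerm α b t k) =
      Complex.exp (((2 : ℝ) ^ k * t : ℝ) * Complex.I) := by
  have h2 : (0 : ℝ) < 2 ^ k := by positivity
  have h : ((2 : ℝ) ^ k) ^ (-α) * dyadicWeight α (k + 1) = 1 := by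
    rw [dyadicWeight, Nat.add_sub_cancel, ← Real.rpow_add h2, neg_add_cancel, Real.rpow_zero]
  rw [lacunaryTerm, inner_smul_right, hb.inner_self, mul_right_comm, ← Complex.ofReal_mul, h,
    Complex.ofReal_one, one_mul]

/-- A Hölder continuous curve in `V` with prescribed oscillating coefficients. -/
theorem exists_lacunary_curve [CompleteSpace V] (hα0 : 0 < α) (hα1 : α < 1)
    (hb : IsDyadicSystem α j b) :
    ∃ ε : ℂ, ε ≠ 0 ∧ ∃ z : ℝ → V, (∀ t, ‖z t‖ ≤ 1 / 2) ∧
      (∃ K ≥ 0, ∀ t s, ‖z t - z s‖ ≤ K * |t - s| ^ (α / 2)) ∧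
      (∀ t, inner ℂ (b 0) (z t) = (0 : ℂ)) ∧
      ∀ k t, inner ℂ (b (k + 1)) (z t) =
        ε * Complex.exp (((2 : ℝ) ^ k * t : ℝ) * Complex.I) := by
  set q : ℝ := 2 ^ (-(α / 2)) with hq
  have hq0 : 0 < q := by positivity
  have hq1 : q < 1 := Real.rpow_lt_one_of_one_lt_of_neg one_lt_two (by linarith)
  have hgeo := summable_geometric_of_lt_one hq0.le hq1
  have hsum : ∀ t, Summable fun k => ‖lacunaryTerm α b t k‖ := fun t => by
    simpa only [norm_lacunaryTerm hb] using hgeo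
  -- The geometric series bounds the lacunary sum by `(1 - q)⁻¹`; this scaling brings it down to `1
  -- / 2`, as coercivity requires.
  set ε : ℝ := (1 - q) / 2 with hε
  have hε0 : 0 < ε := by rw [hε]; linarith
  obtain ⟨C, hC⟩ := exists_sum_dyadic_min_le (β := α / 2) (by linarith) (by linarith)
  have hC0 : 0 ≤ C := by simpa using hC 1 one_pos 0
  have hinner : ∀ n t, inner ℂ (b n) (∑' k, lacunaryTerm α b t k) =
      ∑' k, inner ℂ (b n) (lacunaryTerm α b t k) := fun n t =>
    (innerSL ℂ (b n)).map_tsum (hsum t).of_norm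
  refine ⟨ε, by exact_mod_cast hε0.ne', fun t => (ε : ℂ) • ∑' k, lacunaryTerm α b t k,
    fun t => ?_, ⟨ε * (2 * C), by positivity, fun t s => ?_⟩, fun t => ?_, fun k t => ?_⟩
  · rw [norm_smul, Complex.norm_real, Real.norm_of_nonneg hε0.le]
    have h1 : ‖∑' k, lacunaryTerm α b t k‖ ≤ (1 - q)⁻¹ := by
      refine (norm_tsum_le_tsum_norm (hsum t)).trans ?_
      simp only [norm_lacunaryTerm hb]
      rw [tsum_geometric_of_lt_one hq0.le hq1]
    calc ε * ‖∑' k, lacunaryTerm α b t k‖ ≤ ε * (1 - q)⁻¹ := by gcongr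
      _ = 1 / 2 := by
        have : 1 - q ≠ 0 := by linarith
        rw [hε]; field_simp
  · rcases eq_or_ne t s with rfl | hts
    · simp only [sub_self, norm_zero]; positivity
    rw [← smul_sub, ← (hsum t).of_norm.tsum_sub (hsum s).of_norm, norm_smul, Complex.norm_real,
      Real.norm_of_nonneg hε0.le, mul_assoc]
    refine mul_le_mul_of_nonneg_left ?_ hε0.le
    have hpart : ∀ n, ∑ k ∈ Finset.range n, ‖lacunaryTerm α b t k - lacunaryTerm α b s k‖ ≤
        2 * C * |t - s| ^ (α / 2) := by
      intro n
      refine (Finset.sum_le_sum fun k _ => norm_lacunaryTerm_sub_le hb hts k).trans ?_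
      rw [← Finset.mul_sum]
      have := hC |t - s| (abs_pos.2 (sub_ne_zero.2 hts)) n
      calc _ ≤ 2 * |t - s| ^ (α / 2) * C := by gcongr
        _ = _ := by ring
    have hs : Summable fun k => ‖lacunaryTerm α b t k - lacunaryTerm α b s k‖ :=
      summable_of_sum_range_le (fun _ => norm_nonneg _) hpart
    exact (norm_tsum_le_tsum_norm hs).trans (hs.tsum_le_of_sum_range_le hpart)
  · rw [inner_smul_right, hinner]
    simp [inner_lacunaryTerm_of_ne hb t (Nat.succ_ne_zero _).symm]
  · rw [inner_smul_right, hinner, tsum_eq_single k, inner_lacunaryTerm_self hb]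
    intro m hm
    exact inner_lacunaryTerm_of_ne hb t (by omega)

end Lacunary

/-- The form `a(u, v) = (u, v)_V + (u, p)_V (z, v)_V`. -/
noncomputable def rankOneForm (p z : V) : V →ₗ[ℂ] V →ₗ⋆[ℂ] ℂ :=
  LinearMap.mk₂'ₛₗ (RingHom.id ℂ) (starRingEnd ℂ)
    (fun u v => inner ℂ v u + inner ℂ p u * inner ℂ v z)
    (fun u u' v => by simp only [inner_add_right]; ring)
    (fun c u v => by simp only [inner_smul_right, RingHom.id_apply, smul_eq_mul]; ring)
    (fun u v v' => by simp only [inner_add_left]; ring)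
    (fun c u v => by simp only [inner_smul_left, smul_eq_mul]; ring)

theorem rankOneForm_apply (p z u v : V) :
    rankOneForm p z u v = inner ℂ v u + inner ℂ p u * inner ℂ v z := rfl

/-- By Cauchy–Schwarz the rank-one term is at most half of `‖u‖ * ‖v‖`, so it cannot consume more
than half of the coercivity of the inner product. -/
theorem isBoundedCoercive_rankOneForm (τ : ℝ) {p : V} (hp : ‖p‖ = 1) {z : ℝ → V}
    (hz : ∀ t, ‖z t‖ ≤ 1 / 2) : IsBoundedCoercive τ fun t => rankOneForm p (z t) := by
  have hcross : ∀ t u v, ‖inner ℂ p u * inner ℂ v (z t)‖ ≤ 1 / 2 * (‖u‖ * ‖v‖) := by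
    intro t u v
    rw [norm_mul]
    have h1 : ‖inner ℂ p u‖ ≤ ‖u‖ := by simpa [hp] using norm_inner_le_norm (𝕜 := ℂ) p u
    have h2 : ‖inner ℂ v (z t)‖ ≤ ‖v‖ * (1 / 2) :=
      (norm_inner_le_norm v (z t)).trans (by gcongr; exact hz t)
    calc _ ≤ ‖u‖ * (‖v‖ * (1 / 2)) := by gcongr
      _ = _ := by ring
  refine ⟨2, 1 / 2, by norm_num, by norm_num, fun t _ => ⟨fun u v => ?_, fun u => ?_⟩⟩
  · rw [rankOneForm_apply]
    refine (norm_add_le _ _).trans ?_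
    have h1 := norm_inner_le_norm (𝕜 := ℂ) v u
    have h2 := hcross t u v
    have h3 : 0 ≤ ‖u‖ * ‖v‖ := by positivity
    nlinarith
  · rw [rankOneForm_apply, Complex.add_re]
    have h1 : (inner ℂ u u : ℂ).re = ‖u‖ ^ 2 := inner_self_eq_norm_sq (𝕜 := ℂ) u
    have h2 := (Complex.abs_re_le_norm _).trans (hcross t u u)
    have h3 := neg_abs_le (inner ℂ p u * inner ℂ u (z t) : ℂ).re
    rw [h1]; nlinarith

theorem isHolderForm_rankOneForm (τ β : ℝ) {p : V} (hp : ‖p‖ = 1) {z : ℝ → V}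
    {K : ℝ} (hK : 0 ≤ K) (hz : ∀ t s, ‖z t - z s‖ ≤ K * |t - s| ^ β) :
    IsHolderForm τ β fun t => rankOneForm p (z t) := by
  refine ⟨K, hK, fun t _ s _ u v => ?_⟩
  simp only [rankOneForm_apply]
  rw [add_sub_add_left_eq_sub, ← mul_sub, ← inner_sub_right, norm_mul]
  have h1 : ‖inner ℂ p u‖ ≤ ‖u‖ := by simpa [hp] using norm_inner_le_norm (𝕜 := ℂ) p u
  have h2 : ‖inner ℂ v (z t - z s)‖ ≤ ‖v‖ * (K * |t - s| ^ β) :=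
    (norm_inner_le_norm v (z t - z s)).trans (by gcongr; exact hz t s)
  calc _ ≤ ‖u‖ * (‖v‖ * (K * |t - s| ^ β)) := by gcongr
    _ = _ := by ring

/-- Taking the inner product with a fixed vector in the equation defining the Caputo derivative
with initial value zero. -/
theorem HasCaputoDeriv.inner [CompleteSpace H] {α τ : ℝ} (hα1 : α < 1) {u g : ℝ → H}
    (h : HasCaputoDeriv α τ u 0 g) (y : H) :
    ∀ᵐ t ∂volume.restrict (Ioo 0 τ),
      ∫ s in (0 : ℝ)..t, fracKernel α (t - s) • (inner ℂ y (u s) : ℂ) =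
        ∫ s in (0 : ℝ)..t, (inner ℂ y (g s) : ℂ) := by
  rcases le_or_gt τ 0 with hτ | hτ
  · simp [Ioo_eq_empty (not_lt.2 hτ)]
  have hk : IntegrableOn (fracKernel α) (Ioo 0 τ) :=
    (intervalIntegrable_iff_integrableOn_Ioo_of_le hτ.le).1 (intervalIntegrable_fracKernel hα1 0 τ)
  -- Moving the functional inside the integral requires `s ↦ k(t - s) u(s)` to be integrable, which
  -- holds for almost every `t`.
  filter_upwards [h.primitive, ae_intervalIntegrable_kernel_smul hk h.integrable,
    ae_restrict_mem measurableSet_Ioo] with t ht hinteg htτ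
  have hg : IntervalIntegrable g volume 0 t :=
    (intervalIntegrable_iff_integrableOn_Ioo_of_le htτ.1.le).2
      (h.integrable_deriv.mono_set (Ioo_subset_Ioo_right htτ.2.le))
  have h1 := (innerSL ℂ y).intervalIntegral_comp_comm hinteg
  have h2 := (innerSL ℂ y).intervalIntegral_comp_comm hg
  simp only [sub_zero] at ht
  rw [← ht, ← h1] at h2
  simp only [innerSL_apply_apply] at h2
  rw [h2]
  refine intervalIntegral.integral_congr fun s _ => ?_
  simp only [← Complex.coe_smul, inner_smul_right, smul_eq_mul]

/-- The coordinate `n` of the identity `A x = y`. -/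
theorem OperatorGraph.inner_eq {α : ℝ} {j : V →L[ℂ] H} {b : ℕ → V} (hb : IsDyadicSystem α j b)
    {z : V} {x y : H} (h : OperatorGraph j (rankOneForm (b 0) z) x y) (n : ℕ) :
    inner ℂ (j (b n)) y = (dyadicWeight α n : ℂ) * inner ℂ (j (b n)) x +
      inner ℂ (j (b 0)) x * inner ℂ (b n) z := by
  obtain ⟨u, rfl, hu⟩ := h
  rw [← hu (b n), rankOneForm_apply, hb.inner_eq n, hb.inner_eq 0]
  simp [dyadicWeight]

/-- The constant right-hand side `j (b 0)` already suffices: the high coordinates force the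
coordinate of `u` along `b 0` to vanish, although that coordinate is driven by the constant `1`. -/
theorem exists_form_without_maximal_regularity [CompleteSpace V] [CompleteSpace H] {α τ : ℝ}
    (hα0 : 0 < α) (hα1 : α < 1) (hτ : 0 < τ) {j : V →L[ℂ] H} {b : ℕ → V}
    (hb : IsDyadicSystem α j b) :
    ∃ a : ℝ → V →ₗ[ℂ] V →ₗ⋆[ℂ] ℂ, IsBoundedCoercive τ a ∧ IsHolderForm τ (α / 2) a ∧
      ∃ f : ℝ → H, MemLp f 2 (volume.restrict (Ioo 0 τ)) ∧
        ¬ ∃ u : ℝ → H, IsMaxRegSolution α τ j a 0 f u := by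
  obtain ⟨ε, hε, z, hz, ⟨K, hK, hzK⟩, hz0, hzk⟩ := exists_lacunary_curve hα0 hα1 hb
  refine ⟨fun t => rankOneForm (b 0) (z t), isBoundedCoercive_rankOneForm τ hb.norm_zero hz,
    isHolderForm_rankOneForm τ _ hb.norm_zero hK hzK, fun _ => j (b 0), memLp_const _, ?_⟩
  rintro ⟨u, g, h, hcap, -, hh2, hgraph, hgh⟩
  have hh : IntegrableOn h (Ioo 0 τ) := hh2.integrable one_le_two
  have hcomp : ∀ {φ : ℝ → H}, IntegrableOn φ (Ioo 0 τ) → ∀ n,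
      IntegrableOn (fun t => (inner ℂ (j (b n)) (φ t) : ℂ)) (Ioo 0 τ) := fun hφ n =>
    (innerSL ℂ (j (b n))).integrable_comp hφ
  have hprim : ∀ n, ∀ᵐ t ∂volume.restrict (Ioo 0 τ),
      ∫ s in (0 : ℝ)..t, fracKernel α (t - s) • (inner ℂ (j (b n)) (u s) : ℂ) =
        ∫ s in (0 : ℝ)..t, (inner ℂ (j (b n)) (j (b 0)) - inner ℂ (j (b n)) (h s) : ℂ) := by
    intro n
    filter_upwards [hcap.inner hα1 (j (b n)), ae_restrict_mem measurableSet_Ioo] with t ht htτ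
    rw [ht]
    refine intervalIntegral_congr_ae_Ioo htτ.1.le ?_
    filter_upwards [ae_mono (Measure.restrict_mono (Ioo_subset_Ioo_right htτ.2.le) le_rfl) hgh]
      with s hs
    rw [← hs, inner_add_right, add_sub_cancel_right]
  have hu0 : ∀ᵐ t ∂volume.restrict (Ioo 0 τ), inner ℂ (j (b 0)) (u t) = (0 : ℂ) := by
    refine ae_eq_zero_of_tendsto_components hα0 hα1 (ω := fun k => 2 ^ k) (fun k => by positivity)
      (tendsto_pow_atTop_atTop_of_one_lt one_lt_two) (ε := ε) hε
      (v := fun k t => inner ℂ (j (b (k + 1))) (u t))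
      (h := fun k t => inner ℂ (j (b (k + 1))) (h t)) (B := fun t => ‖h t‖)
      (hcomp hcap.integrable 0) (fun k => hcomp hcap.integrable (k + 1))
      (fun k => hcomp hh (k + 1)) hh.norm (fun k t => ?_) (fun t => ?_) (fun k => ?_) (fun k => ?_)
    · simpa [hb.orthonormal.1] using norm_inner_le_norm (𝕜 := ℂ) (j (b (k + 1))) (h t)
    -- Bessel's inequality: this is where `h t ∈ H`, rather than merely in `V'`, is decisive.
    · have h1 := (hb.orthonormal.inner_products_summable (h t)).tendsto_atTop_zero
      have h2 := (h1.comp (tendsto_add_atTop_nat 1)).sqrt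
      rw [tendsto_zero_iff_norm_tendsto_zero]
      simpa [Function.comp_def, Real.sqrt_sq] using h2
    · filter_upwards [hprim (k + 1)] with t ht
      rw [ht, hb.orthonormal.2 (Nat.succ_ne_zero k)]
      simp only [zero_sub, intervalIntegral.integral_neg]
    · filter_upwards [hgraph] with t ht
      rw [ht.inner_eq hb, hzk]
      simp only [dyadicWeight, Nat.add_sub_cancel]
      ring
  -- Both contributions to this coordinate of `A(t) u(t)` contain the factor `(b 0, u)`, which is
  -- zero.
  have hh0 : ∀ᵐ t ∂volume.restrict (Ioo 0 τ), inner ℂ (j (b 0)) (h t) = (0 : ℂ) := by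
    filter_upwards [hgraph, hu0] with t ht hut
    rw [ht.inner_eq hb, hut, mul_zero, zero_mul, add_zero]
  have hone : inner ℂ (j (b 0)) (j (b 0)) = (1 : ℂ) := by
    rw [inner_self_eq_norm_sq_to_K, hb.orthonormal.1 0]; simp
  -- The integrated equation along `b 0` now says `0 = t` for almost every `t` in `(0, τ)`.
  have hfalse : ∀ᵐ t ∂volume.restrict (Ioo 0 τ), False := by
    filter_upwards [hprim 0, ae_restrict_mem measurableSet_Ioo] with t ht htτ
    have hμ : volume.restrict (Ioo 0 t) ≤ volume.restrict (Ioo 0 τ) :=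
      Measure.restrict_mono (Ioo_subset_Ioo_right htτ.2.le) le_rfl
    have h1 : ∫ s in (0 : ℝ)..t, fracKernel α (t - s) • (inner ℂ (j (b 0)) (u s) : ℂ) =
        ∫ s in (0 : ℝ)..t, (0 : ℂ) := by
      refine intervalIntegral_congr_ae_Ioo htτ.1.le ?_
      filter_upwards [ae_mono hμ hu0] with s hs
      rw [hs, smul_zero]
    have h2 : ∫ s in (0 : ℝ)..t, (inner ℂ (j (b 0)) (j (b 0)) - inner ℂ (j (b 0)) (h s) : ℂ) =
        ∫ s in (0 : ℝ)..t, (1 : ℂ) := by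
      refine intervalIntegral_congr_ae_Ioo htτ.1.le ?_
      filter_upwards [ae_mono hμ hh0] with s hs
      rw [hs, hone, sub_zero]
    rw [h1, h2] at ht
    simp only [intervalIntegral.integral_zero, intervalIntegral.integral_const, sub_zero,
      Complex.real_smul, mul_one] at ht
    exact htτ.1.ne (by exact_mod_cast ht)
  rw [eventually_false_iff_eq_bot, ae_eq_bot, Measure.restrict_eq_zero] at hfalse
  rw [Real.volume_Ioo, ENNReal.ofReal_eq_zero] at hfalse
  linarith

end AbstractCounterexample

/-! ### The weighted space as a dense subspace of `L₂[0,1]`. -/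

section Embedding

variable {w : ℝ → ℝ}

theorem IsWeight.ae_one_le (hw : IsWeight w) :
    ∀ᵐ x ∂volume.restrict (Icc (0 : ℝ) 1), 1 ≤ w x := by
  filter_upwards [ae_restrict_mem measurableSet_Icc] with x hx using hw.one_le x hx

theorem IsWeight.restrict_le (hw : IsWeight w) :
    volume.restrict (Icc (0 : ℝ) 1) ≤ weightedMeasure w := by
  rw [weightedMeasure]
  conv_lhs => rw [← withDensity_one (μ := volume.restrict (Icc (0 : ℝ) 1))]
  refine withDensity_mono ?_
  filter_upwards [hw.ae_one_le] with x hx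
  simpa using hx

theorem weightedMeasure_absolutelyContinuous :
    weightedMeasure w ≪ volume.restrict (Icc (0 : ℝ) 1) :=
  withDensity_absolutelyContinuous _ _

/-- The natural embedding of the weighted space into `L₂[0,1]`. -/
noncomputable def weightEmbedding (hw : IsWeight w) : VSpace w →L[ℂ] HSpace :=
  LinearMap.mkContinuous
    { toFun := fun v => ((Lp.memLp v).mono_measure hw.restrict_le).toLp v
      map_add' := fun u v => by
        rw [← MemLp.toLp_add]
        exact MemLp.toLp_congr _ _ (hw.restrict_le.absolutelyContinuous (Lp.coeFn_add u v))
      map_smul' := fun c v => by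
        rw [RingHom.id_apply, ← MemLp.toLp_const_smul]
        exact MemLp.toLp_congr _ _ (hw.restrict_le.absolutelyContinuous (Lp.coeFn_smul c v)) }
    1 fun v => by
      rw [one_mul, LinearMap.coe_mk, AddHom.coe_mk, Lp.norm_toLp, Lp.norm_def]
      exact ENNReal.toReal_mono (Lp.eLpNorm_ne_top v) (eLpNorm_mono_measure _ hw.restrict_le)

theorem coeFn_weightEmbedding (hw : IsWeight w) (v : VSpace w) :
    ⇑(weightEmbedding hw v) =ᵐ[volume.restrict (Icc (0 : ℝ) 1)] ⇑v :=
  MemLp.coeFn_toLp ((Lp.memLp v).mono_measure hw.restrict_le)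

theorem weightEmbedding_injective (hw : IsWeight w) :
    Function.Injective (weightEmbedding hw) := by
  intro u v h
  refine Lp.ext (weightedMeasure_absolutelyContinuous ?_)
  have h1 := coeFn_weightEmbedding hw u
  rw [h] at h1
  exact h1.symm.trans (coeFn_weightEmbedding hw v)

/-- If `y` is square integrable, then `y / w` belongs to the weighted space. -/
theorem memLp_weight_inv_smul (hw : IsWeight w) (y : HSpace) :
    MemLp (fun x => (w x)⁻¹ • y x) 2 (weightedMeasure w) := by
  have hym : AEStronglyMeasurable y (volume.restrict (Icc (0 : ℝ) 1)) :=
    Lp.aestronglyMeasurable y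
  have hm : AEStronglyMeasurable (fun x => (w x)⁻¹ • y x) (volume.restrict (Icc (0 : ℝ) 1)) :=
    hw.measurable.inv.aestronglyMeasurable.smul hym
  rw [memLp_two_iff_integrable_sq_norm (hm.mono_ac weightedMeasure_absolutelyContinuous),
    weightedMeasure, integrable_withDensity_iff (by have := hw.measurable; fun_prop)
      (ae_of_all _ fun _ => ENNReal.ofReal_lt_top)]
  have hy := (memLp_two_iff_integrable_sq_norm hym).1 (Lp.memLp y)
  have hwm := hw.measurable
  refine hy.mono' ((hm.norm.pow 2).mul hwm.ennreal_ofReal.ennreal_toReal.aestronglyMeasurable) ?_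
  filter_upwards [hw.ae_one_le] with x hx
  have hw0 : 0 < w x := one_pos.trans_le hx
  rw [ENNReal.toReal_ofReal hw0.le, Real.norm_of_nonneg (by positivity), norm_smul, norm_inv,
    Real.norm_of_nonneg hw0.le]
  have : ((w x)⁻¹ * ‖y x‖) ^ 2 * w x = (w x)⁻¹ * ‖y x‖ ^ 2 := by field_simp
  rw [this]
  exact mul_le_of_le_one_left (by positivity) (inv_le_one_of_one_le₀ hx)

/-- If `y` is orthogonal to the range, testing with `y / w`, which lies in the weighted space, gives
`∫ |y|² / w = 0` and hence `y = 0`. -/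
theorem weightEmbedding_denseRange (hw : IsWeight w) : DenseRange (weightEmbedding hw) := by
  have hperp : (LinearMap.range (weightEmbedding hw).toLinearMap)ᗮ = ⊥ := by
    rw [Submodule.eq_bot_iff]
    intro y hy
    have h0 := (Submodule.mem_orthogonal _ _).1 hy _
      (LinearMap.mem_range_self _ ((memLp_weight_inv_smul hw y).toLp _))
    have hae : ⇑(weightEmbedding hw ((memLp_weight_inv_smul hw y).toLp _))
        =ᵐ[volume.restrict (Icc (0 : ℝ) 1)] fun x => (w x)⁻¹ • y x :=
      (coeFn_weightEmbedding hw _).trans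
        (hw.restrict_le.absolutelyContinuous (MemLp.coeFn_toLp _))
    have h1 : inner ℂ (weightEmbedding hw ((memLp_weight_inv_smul hw y).toLp _)) y =
        ∫ x, (((w x)⁻¹ * ‖y x‖ ^ 2 : ℝ) : ℂ) ∂volume.restrict (Icc (0 : ℝ) 1) := by
      rw [L2.inner_def]
      refine integral_congr_ae ?_
      filter_upwards [hae] with x hx
      rw [hx, ← Complex.coe_smul, inner_smul_left, inner_self_eq_norm_sq_to_K, Complex.conj_ofReal]
      push_cast; rfl
    rw [integral_complex_ofReal] at h1
    have h2 : ∫ x, (w x)⁻¹ * ‖y x‖ ^ 2 ∂volume.restrict (Icc (0 : ℝ) 1) = 0 := by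
      have := h1.symm.trans h0
      exact_mod_cast this
    have hym : AEStronglyMeasurable y (volume.restrict (Icc (0 : ℝ) 1)) :=
      Lp.aestronglyMeasurable y
    have hinteg : Integrable (fun x => (w x)⁻¹ * ‖y x‖ ^ 2) (volume.restrict (Icc (0 : ℝ) 1)) := by
      refine ((memLp_two_iff_integrable_sq_norm hym).1 (Lp.memLp y)).mono'
        (hw.measurable.inv.aestronglyMeasurable.mul (hym.norm.pow 2)) ?_
      filter_upwards [hw.ae_one_le] with x hx
      have hw0 : 0 < w x := one_pos.trans_le hx
      rw [Real.norm_of_nonneg (by positivity)]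
      exact mul_le_of_le_one_left (by positivity) (inv_le_one_of_one_le₀ hx)
    have hnn : 0 ≤ᵐ[volume.restrict (Icc (0 : ℝ) 1)] fun x => (w x)⁻¹ * ‖y x‖ ^ 2 := by
      filter_upwards [hw.ae_one_le] with x hx
      have hw0 : 0 < w x := one_pos.trans_le hx
      exact mul_nonneg (by positivity) (by positivity)
    have h3 := (integral_eq_zero_iff_of_nonneg_ae hnn hinteg).1 h2
    rw [Lp.eq_zero_iff_ae_eq_zero]
    filter_upwards [h3, hw.ae_one_le] with x hx hwx
    have hw0 : (w x)⁻¹ ≠ 0 := inv_ne_zero (by linarith)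
    simpa [hw0] using hx
  have h := Submodule.topologicalClosure_eq_top_iff.2 hperp
  have h2 := (Submodule.dense_iff_topologicalClosure_eq_top.2 h)
  rwa [LinearMap.coe_range] at h2

theorem isGelfandEmbedding_weightEmbedding (hw : IsWeight w) :
    IsGelfandEmbedding (weightEmbedding hw) :=
  ⟨weightEmbedding_injective hw, weightEmbedding_denseRange hw⟩

end Embedding

/-! ### The concrete step weight and its normalized indicators. -/

section DyadicStepWeight

/-- The step function equal to `dyadicWeight α n` on `(2^{-n-1}, 2^{-n}]`. -/
noncomputable def stepWeight (α : ℝ) (x : ℝ) : ℝ := dyadicWeight α ⌊-Real.logb 2 x⌋₊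

/-- The interval `(2^{-n-1}, 2^{-n}]`. -/
def dyadicInterval (n : ℕ) : Set ℝ := Ioc ((2 : ℝ)⁻¹ ^ (n + 1)) ((2 : ℝ)⁻¹ ^ n)

theorem measurableSet_dyadicInterval (n : ℕ) : MeasurableSet (dyadicInterval n) :=
  measurableSet_Ioc

theorem floor_neg_logb_of_mem {n : ℕ} {x : ℝ} (hx : x ∈ dyadicInterval n) :
    ⌊-Real.logb 2 x⌋₊ = n := by
  have hx0 : 0 < x := lt_trans (by positivity) hx.1
  have hpow : ∀ m : ℕ, Real.logb 2 ((2 : ℝ)⁻¹ ^ m) = -m := fun m => by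
    rw [Real.logb_pow, Real.logb_inv, Real.logb_self_eq_one one_lt_two]; ring
  have h1 := Real.logb_lt_logb one_lt_two (by positivity) hx.1
  have h2 := Real.logb_le_logb_of_le one_lt_two hx0 hx.2
  rw [hpow] at h1 h2
  push_cast at h1
  rw [Nat.floor_eq_iff (by have : (0 : ℝ) ≤ n := n.cast_nonneg; linarith)]
  constructor <;> linarith

theorem stepWeight_of_mem (α : ℝ) {n : ℕ} {x : ℝ} (hx : x ∈ dyadicInterval n) :
    stepWeight α x = dyadicWeight α n := by
  rw [stepWeight, floor_neg_logb_of_mem hx]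

/-- The step weight is nonincreasing on `(0, ∞)`, so its value at `δ` bounds it on `[δ, 1]`. At `x =
0` the convention `Real.logb 2 0 = 0` gives the harmless value `1`. -/
theorem isWeight_stepWeight {α : ℝ} (hα : 0 ≤ α) : IsWeight (stepWeight α) where
  measurable := by
    have h : Measurable fun x : ℝ => ⌊-Real.logb 2 x⌋₊ :=
      Nat.measurable_floor.comp (by unfold Real.logb; fun_prop)
    exact (measurable_from_nat (f := dyadicWeight α)).comp h
  one_le := fun _ _ => one_le_dyadicWeight hα _
  locallyBounded := fun δ hδ => ⟨stepWeight α δ, fun x hx => by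
    refine dyadicWeight_mono hα (Nat.floor_mono ?_)
    have := Real.logb_le_logb_of_le one_lt_two hδ hx.1
    linarith⟩

theorem dyadicInterval_subset (n : ℕ) : dyadicInterval n ⊆ Icc 0 1 := fun _ hx =>
  ⟨(lt_trans (by positivity) hx.1).le, hx.2.trans (pow_le_one₀ (by norm_num) (by norm_num))⟩

theorem dyadicInterval_disjoint {m n : ℕ} (h : m ≠ n) :
    dyadicInterval m ∩ dyadicInterval n = ∅ := by
  rw [eq_empty_iff_forall_notMem]
  exact fun x hx => h ((floor_neg_logb_of_mem hx.1).symm.trans (floor_neg_logb_of_mem hx.2))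

theorem measureReal_dyadicInterval (n : ℕ) :
    (volume.restrict (Icc (0 : ℝ) 1)).real (dyadicInterval n) = (2 : ℝ)⁻¹ ^ (n + 1) := by
  rw [measureReal_restrict_apply (measurableSet_dyadicInterval n),
    inter_eq_left.2 (dyadicInterval_subset n), dyadicInterval, Real.volume_real_Ioc_of_le]
  · rw [pow_succ]; ring
  · exact pow_le_pow_of_le_one (by norm_num) (by norm_num) n.le_succ

theorem restrict_weightedMeasure_dyadicInterval (α : ℝ) (n : ℕ) :
    (weightedMeasure (stepWeight α)).restrict (dyadicInterval n) =
      ENNReal.ofReal (dyadicWeight α n) •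
        (volume.restrict (Icc (0 : ℝ) 1)).restrict (dyadicInterval n) := by
  rw [weightedMeasure, restrict_withDensity (measurableSet_dyadicInterval n), ← withDensity_const]
  refine withDensity_congr_ae ?_
  filter_upwards [ae_restrict_mem (measurableSet_dyadicInterval n)] with x hx
  rw [stepWeight_of_mem α hx]

theorem weightedMeasure_dyadicInterval_ne_top (α : ℝ) (n : ℕ) :
    weightedMeasure (stepWeight α) (dyadicInterval n) ≠ ⊤ := by
  rw [← Measure.restrict_apply_self, restrict_weightedMeasure_dyadicInterval, Measure.smul_apply,
    smul_eq_mul]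
  exact ENNReal.mul_ne_top ENNReal.ofReal_ne_top (measure_ne_top _ _)

theorem setIntegral_weightedMeasure_dyadicInterval (α : ℝ) (n : ℕ) (u : ℝ → ℂ) :
    ∫ x in dyadicInterval n, u x ∂weightedMeasure (stepWeight α) =
      (dyadicWeight α n : ℂ) *
        ∫ x in dyadicInterval n, u x ∂volume.restrict (Icc (0 : ℝ) 1) := by
  rw [restrict_weightedMeasure_dyadicInterval, integral_smul_measure,
    ENNReal.toReal_ofReal (dyadicWeight_pos α n).le, Complex.real_smul]

/-- The factor normalizing the indicator function of `dyadicInterval n` in `L₂[0,1]`. -/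
noncomputable def dyadicScale (n : ℕ) : ℝ := (√((2 : ℝ)⁻¹ ^ (n + 1)))⁻¹

/-- The normalized indicator function of `dyadicInterval n`, in the weighted space. -/
noncomputable def dyadicVector (α : ℝ) (n : ℕ) : VSpace (stepWeight α) :=
  (dyadicScale n : ℂ) • indicatorConstLp 2 (measurableSet_dyadicInterval n)
    (weightedMeasure_dyadicInterval_ne_top α n) (1 : ℂ)

theorem weightEmbedding_dyadicVector {α : ℝ} (hα : 0 ≤ α) (n : ℕ) :
    weightEmbedding (isWeight_stepWeight hα) (dyadicVector α n) =
      (dyadicScale n : ℂ) • indicatorConstLp 2 (measurableSet_dyadicInterval n)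
        (measure_ne_top (volume.restrict (Icc (0 : ℝ) 1)) _) (1 : ℂ) := by
  rw [dyadicVector, map_smul]
  congr 1
  refine Lp.ext ((coeFn_weightEmbedding _ _).trans ?_)
  have h := (isWeight_stepWeight hα).restrict_le.absolutelyContinuous.ae_le
    (indicatorConstLp_coeFn (p := 2) (hs := measurableSet_dyadicInterval n)
      (hμs := weightedMeasure_dyadicInterval_ne_top α n) (c := (1 : ℂ)))
  exact EventuallyEq.trans h indicatorConstLp_coeFn.symm

/-- Orthogonality comes from disjoint supports. The weight is constant on the support of each
vector, so pairing with it in the weighted space only multiplies the `L₂[0,1]` pairing by that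
constant. -/
theorem isDyadicSystem_dyadicVector {α : ℝ} (hα : 0 ≤ α) :
    IsDyadicSystem α (weightEmbedding (isWeight_stepWeight hα)) (dyadicVector α) where
  orthonormal := by
    have hinner : ∀ m n, inner ℂ (weightEmbedding (isWeight_stepWeight hα) (dyadicVector α m))
        (weightEmbedding (isWeight_stepWeight hα) (dyadicVector α n)) =
        (dyadicScale m : ℂ) * (dyadicScale n * ((volume.restrict (Icc (0 : ℝ) 1)).real
          (dyadicInterval m ∩ dyadicInterval n) : ℂ)) := fun m n => by
      rw [weightEmbedding_dyadicVector hα, weightEmbedding_dyadicVector hα, inner_smul_left,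
        inner_smul_right, L2.inner_indicatorConstLp_one_indicatorConstLp_one, Complex.conj_ofReal]
      rfl
    refine ⟨fun n => ?_, fun m n h => ?_⟩
    · have h1 := hinner n n
      rw [inter_self, measureReal_dyadicInterval, inner_self_eq_norm_sq_to_K] at h1
      have h2 : dyadicScale n * (dyadicScale n * (2 : ℝ)⁻¹ ^ (n + 1)) = 1 := by
        have h0 : (0 : ℝ) < (2 : ℝ)⁻¹ ^ (n + 1) := by positivity
        have h3 : √((2 : ℝ)⁻¹ ^ (n + 1)) * √((2 : ℝ)⁻¹ ^ (n + 1)) = (2 : ℝ)⁻¹ ^ (n + 1) :=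
          Real.mul_self_sqrt h0.le
        have h4 := (Real.sqrt_pos.2 h0).ne'
        rw [dyadicScale]
        nth_rewrite 3 [← h3]
        field_simp
      have h3 : ‖weightEmbedding (isWeight_stepWeight hα) (dyadicVector α n)‖ ^ 2 = 1 := by
        refine Eq.trans ?_ h2
        apply Complex.ofReal_injective
        push_cast at h1 ⊢
        exact h1
      nlinarith [norm_nonneg (weightEmbedding (isWeight_stepWeight hα) (dyadicVector α n))]
    · beta_reduce
      rw [hinner, dyadicInterval_disjoint h]; simp
  inner_eq := fun n u => by
    rw [weightEmbedding_dyadicVector hα, dyadicVector, inner_smul_left, inner_smul_left,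
      L2.inner_indicatorConstLp_one, L2.inner_indicatorConstLp_one,
      setIntegral_weightedMeasure_dyadicInterval,
      integral_congr_ae (ae_restrict_of_ae (coeFn_weightEmbedding (isWeight_stepWeight hα) u))]
    ring

end DyadicStepWeight

end FracMR

theorem theorem1p2 (α : ℝ) (hα0 : 0 < α) (hα1 : α < 1) (τ : ℝ) (hτ : 0 < τ) :
    ∃ w : ℝ → ℝ, FracMR.IsWeight w ∧
    ∃ j : FracMR.VSpace w →L[ℂ] FracMR.HSpace,
      (∀ v : FracMR.VSpace w, ⇑(j v) =ᵐ[volume.restrict (Icc (0 : ℝ) 1)] ⇑v) ∧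
      FracMR.IsGelfandEmbedding j ∧
    ∃ a : ℝ → FracMR.VSpace w →ₗ[ℂ] FracMR.VSpace w →ₗ⋆[ℂ] ℂ,
      FracMR.IsBoundedCoercive τ a ∧
      FracMR.IsHolderForm τ (α / 2) a ∧
    ∃ f : ℝ → FracMR.HSpace,
      MemLp f 2 (volume.restrict (Ioo 0 τ)) ∧
      ¬ ∃ u : ℝ → FracMR.HSpace, FracMR.IsMaxRegSolution α τ j a 0 f u := by
  exact ⟨FracMR.stepWeight α, FracMR.isWeight_stepWeight hα0.le,
    FracMR.weightEmbedding (FracMR.isWeight_stepWeight hα0.le),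
    FracMR.coeFn_weightEmbedding _, FracMR.isGelfandEmbedding_weightEmbedding _,
    FracMR.exists_form_without_maximal_regularity hα0 hα1 hτ
      (FracMR.isDyadicSystem_dyadicVector hα0.le)⟩
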